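/- Let $k,M\in\mathbb N$, $E>0$, $N\ge 0$. On the single-mode Fock space $\mathcal F=\ell^2(\mathbb N)$ with number states $|n\rangle$ and annihilation operator $a$, let $D(\alpha)=\exp(\alpha a^\dagger-\bar\alpha a)$ be the displacement operator ($\alpha\in\mathbb C$), let $\tau_N=\sum_{n\ge 0}\frac{N^n}{(N+1)^{n+1}}|n\rangle\langle n|$ be the thermal state with mean photon number $N$ (with $0^0=1$), and let $S_N(\alpha)=D(\alpha)\tau_ND(\alpha)^\dagger$ be the displaced thermal state. For $\alpha=(\alpha_1,\dots,\alpha_k)\in\mathbb C^k$ put $S_N^k(\alpha)=S_N(\alpha_1)\otimes\cdots\otimes S_N(\alpha_k)$ on $\mathcal F^{\otimes k}$. A $(k,M,\lambda_1,\lambda_2)$ deterministic multi-user identification scheme (with noise $N$ and energy bound $E$) consists of coherent-state signatures $|\alpha_m\rangle=|\alpha_{m,1}\rangle\otimes\cdots\otimes|\alpha_{m,k}\rangle$ with amplitude vectors $\alpha_m\in\mathbb C^k$, $\|\alpha_m\|^2=\sum_{t=1}^k|\alpha_{m,t}|^2\le kE$, and of binary tests $\{\Pi_m,\mathbb 1-\Pi_m\}$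 with $0\le\Pi_m\le\mathbb 1$ on $\mathcal F^{\otimes k}$, $m=1,\dots,M$, such that $$1-\operatorname{tr}[S_N^k(\alpha_m)\Pi_m]\le\lambda_1\quad\text{for all } m,\qquad \operatorname{tr}[S_N^k(\alpha_{m'})\Pi_m]\le\lambda_2\quad\text{for all } m'\ne m.$$ Theorem 2 (converse bound). For every such scheme with $\max\{\lambda_1,\lambda_2\}\le\delta$ and $0<\delta<\tfrac14$, $$M\le\left(1+\frac{4\sqrt{kE}}{\sqrt{(2N+1)\log\bigl(1/(4\delta)\bigr)}}\right)^{2k},$$ where $\log$ is the natural logarithm. -/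

import Mathlib

open scoped ComplexConjugate

namespace BosonicID

/-- The single-mode Fock space `ℓ²(ℕ)`; the coordinate `n` is the amplitude of the number
state `|n⟩`. -/
abbrev Fock : Type := lp (fun _ : ℕ => ℂ) 2

/-- The `k`-mode Fock space, i.e. the `k`-fold Hilbert space tensor product of `Fock`, realised as
`ℓ²(ℕ^k)`; the coordinate `n` is the amplitude of `|n₁⟩ ⊗ ⋯ ⊗ |n_k⟩`. -/
abbrev FockK (k : ℕ) : Type := lp (fun _ : Fin k → ℕ => ℂ) 2

section Displacement

/-- `displacedNumberAmp α n m` is the number-basis coefficient `⟨m| D(α) |n⟩` of the displaced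
number state `D(α)|n⟩`, where `D(α) = exp(α a† - conj(α) a)`.  For `n = 0` this is the coherent
state `|α⟩ = e^{-|α|²/2} ∑ₘ α^m / √(m!) |m⟩`; then
`D(α)|n+1⟩ = (n+1)^{-1/2} D(α) a† |n⟩ = (n+1)^{-1/2} (a† - conj(α)) D(α)|n⟩`. -/
noncomputable def displacedNumberAmp (α : ℂ) : ℕ → ℕ → ℂ
  | 0, m => (Real.exp (-‖α‖ ^ 2 / 2) : ℂ) * α ^ m / (Real.sqrt (Nat.factorial m) : ℂ)
  | n + 1, m =>
      ((Real.sqrt m : ℂ) * displacedNumberAmp α n (m - 1)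
        - conj α * displacedNumberAmp α n m) / (Real.sqrt ((n : ℝ) + 1) : ℂ)

/-- Super-exponential decay of a sequence; used only to justify convergence. -/
def FastDecay (x : ℕ → ℂ) : Prop :=
  ∃ C R : ℝ, 0 ≤ C ∧ 1 ≤ R ∧ ∀ m, ‖x m‖ ≤ C * R ^ m / Real.sqrt (Nat.factorial m)

theorem FastDecay.raise {x : ℕ → ℂ} (hx : FastDecay x) :
    FastDecay (fun m => (Real.sqrt m : ℂ) * x (m - 1)) := by
  obtain ⟨C, R, hC, hR, h⟩ := hx
  refine ⟨C, 2 * R, hC, by linarith, fun m => ?_⟩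
  rcases m with _ | m
  · simp [hC]
  · have hs : (0 : ℝ) < Real.sqrt (Nat.factorial m) :=
      Real.sqrt_pos.2 (by exact_mod_cast Nat.factorial_pos m)
    have hs1 : (0 : ℝ) < Real.sqrt ((m : ℝ) + 1) := Real.sqrt_pos.2 (by positivity)
    have e : Real.sqrt (Nat.factorial (m + 1)) =
        Real.sqrt ((m : ℝ) + 1) * Real.sqrt (Nat.factorial m) := by
      rw [Nat.factorial_succ, Nat.cast_mul, Real.sqrt_mul (by positivity)]
      push_cast; rfl
    have h1 := h m
    have h2 : ((m : ℝ) + 1) ≤ 2 ^ (m + 1) := by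
      have : m + 1 < 2 ^ (m + 1) := Nat.lt_two_pow_self
      exact_mod_cast this.le
    have h3 : R ^ m ≤ R ^ (m + 1) := pow_le_pow_right₀ hR (Nat.le_succ m)
    rw [norm_mul, Complex.norm_real, Real.norm_of_nonneg (Real.sqrt_nonneg _), e,
      le_div_iff₀ (by positivity), Nat.add_sub_cancel, Nat.cast_add, Nat.cast_one, mul_pow]
    rw [le_div_iff₀ hs] at h1
    have h4 : Real.sqrt ((m : ℝ) + 1) * Real.sqrt ((m : ℝ) + 1) = m + 1 :=
      Real.mul_self_sqrt (by positivity)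
    calc Real.sqrt ((m : ℝ) + 1) * ‖x m‖ * (Real.sqrt ((m : ℝ) + 1) *
            Real.sqrt (Nat.factorial m))
        = (Real.sqrt ((m : ℝ) + 1) * Real.sqrt ((m : ℝ) + 1)) *
            (‖x m‖ * Real.sqrt (Nat.factorial m)) := by ring
      _ = ((m : ℝ) + 1) * (‖x m‖ * Real.sqrt (Nat.factorial m)) := by rw [h4]
      _ ≤ 2 ^ (m + 1) * (C * R ^ (m + 1)) := by
          refine mul_le_mul h2 (h1.trans ?_) (by positivity) (by positivity)
          exact mul_le_mul_of_nonneg_left h3 hC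
      _ = C * (2 ^ (m + 1) * R ^ (m + 1)) := by ring

theorem FastDecay.lower {x : ℕ → ℂ} (hx : FastDecay x) :
    FastDecay (fun m => (Real.sqrt ((m : ℝ) + 1) : ℂ) * x (m + 1)) := by
  obtain ⟨C, R, hC, hR, h⟩ := hx
  refine ⟨C * R, R, by positivity, hR, fun m => ?_⟩
  have hs : (0 : ℝ) < Real.sqrt (Nat.factorial m) :=
    Real.sqrt_pos.2 (by exact_mod_cast Nat.factorial_pos m)
  have hs1 : (0 : ℝ) < Real.sqrt ((m : ℝ) + 1) := Real.sqrt_pos.2 (by positivity)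
  have e : Real.sqrt (Nat.factorial (m + 1)) =
      Real.sqrt ((m : ℝ) + 1) * Real.sqrt (Nat.factorial m) := by
    rw [Nat.factorial_succ, Nat.cast_mul, Real.sqrt_mul (by positivity)]
    push_cast; rfl
  have h1 := h (m + 1)
  rw [e, le_div_iff₀ (by positivity)] at h1
  rw [norm_mul, Complex.norm_real, Real.norm_of_nonneg (Real.sqrt_nonneg _), le_div_iff₀ hs]
  calc _ = ‖x (m + 1)‖ * (Real.sqrt ((m : ℝ) + 1) * Real.sqrt (Nat.factorial m)) := by ring
    _ ≤ _ := h1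
    _ = _ := by ring

theorem FastDecay.sub {x y : ℕ → ℂ} (hx : FastDecay x) (hy : FastDecay y) :
    FastDecay (fun m => x m - y m) := by
  obtain ⟨C, R, hC, hR, h⟩ := hx
  obtain ⟨C', R', hC', hR', h'⟩ := hy
  refine ⟨C + C', max R R', by positivity, le_max_of_le_left hR, fun m => ?_⟩
  refine (norm_sub_le _ _).trans ((add_le_add (h m) (h' m)).trans ?_)
  rw [add_mul, add_div]
  have : 0 ≤ R := by linarith
  have : 0 ≤ R' := by linarith
  gcongr
  · exact le_max_left _ _
  · exact le_max_right _ _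

theorem FastDecay.const_mul {x : ℕ → ℂ} (hx : FastDecay x) (c : ℂ) :
    FastDecay (fun m => c * x m) := by
  obtain ⟨C, R, hC, hR, h⟩ := hx
  refine ⟨‖c‖ * C, R, by positivity, hR, fun m => ?_⟩
  rw [norm_mul, mul_assoc, mul_div_assoc]
  exact mul_le_mul_of_nonneg_left (h m) (norm_nonneg _)

theorem FastDecay.summable_mul {x y : ℕ → ℂ} (hx : FastDecay x) (hy : FastDecay y) :
    Summable (fun m => conj (x m) * y m) := by
  obtain ⟨C, R, hC, hR, h⟩ := hx
  obtain ⟨C', R', hC', hR', h'⟩ := hy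
  refine Summable.of_norm_bounded (g := fun m => C * C' * ((R * R') ^ m / Nat.factorial m))
    ((Real.summable_pow_div_factorial (R * R')).mul_left _) fun m => ?_
  have hs : (0 : ℝ) < Nat.factorial m := by exact_mod_cast Nat.factorial_pos m
  rw [norm_mul, RCLike.norm_conj]
  calc ‖x m‖ * ‖y m‖ ≤ (C * R ^ m / Real.sqrt (Nat.factorial m)) *
        (C' * R' ^ m / Real.sqrt (Nat.factorial m)) :=
        mul_le_mul (h m) (h' m) (norm_nonneg _) (by positivity)
    _ = C * C' * (R * R') ^ m / (Real.sqrt (Nat.factorial m) * Real.sqrt (Nat.factorial m)) := by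
        rw [mul_pow, div_mul_div_comm]; ring
    _ = _ := by rw [Real.mul_self_sqrt hs.le, mul_div_assoc]

theorem fastDecay_displacedNumberAmp (α : ℂ) (n : ℕ) : FastDecay (displacedNumberAmp α n) := by
  induction n with
  | zero =>
    refine ⟨Real.exp (-‖α‖ ^ 2 / 2), 1 + ‖α‖, (Real.exp_pos _).le,
      le_add_of_nonneg_right (norm_nonneg _), fun m => ?_⟩
    rw [displacedNumberAmp, norm_div, norm_mul, Complex.norm_real, Complex.norm_real, norm_pow,
      Real.norm_of_nonneg (Real.exp_pos _).le, Real.norm_of_nonneg (Real.sqrt_nonneg _)]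
    gcongr
    linarith
  | succ n ih =>
    have h := (ih.raise.sub (ih.const_mul (conj α))).const_mul
      ((Real.sqrt ((n : ℝ) + 1) : ℂ)⁻¹)
    convert h using 1
    funext m
    rw [displacedNumberAmp, div_eq_inv_mul]

theorem tsum_raise {x y : ℕ → ℂ} (hx : FastDecay x) (hy : FastDecay y) :
    ∑' m, conj (x m) * ((Real.sqrt m : ℂ) * y (m - 1))
      = ∑' m : ℕ, conj ((Real.sqrt ((m : ℝ) + 1) : ℂ) * x (m + 1)) * y m := by
  rw [(hx.summable_mul hy.raise).tsum_eq_zero_add]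
  simp only [Nat.cast_zero, Real.sqrt_zero, Complex.ofReal_zero, zero_mul, mul_zero, zero_add,
    Nat.add_sub_cancel, map_mul, Complex.conj_ofReal, Nat.cast_add, Nat.cast_one]
  congr 1; funext m; ring

theorem sqrt_mul_self_cast (n : ℕ) :
    (Real.sqrt n : ℂ) * (Real.sqrt n : ℂ) = n := by
  rw [← Complex.ofReal_mul, Real.mul_self_sqrt (by positivity)]; simp

theorem sqrt_succ_ne_zero (n : ℕ) : (Real.sqrt ((n : ℝ) + 1) : ℂ) ≠ 0 := by
  rw [Complex.ofReal_ne_zero]; exact (Real.sqrt_pos.2 (by positivity)).ne'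

theorem displacedNumberAmp_succ (α : ℂ) (n m : ℕ) :
    (Real.sqrt ((n : ℝ) + 1) : ℂ) * displacedNumberAmp α (n + 1) m
      = (Real.sqrt m : ℂ) * displacedNumberAmp α n (m - 1) - conj α * displacedNumberAmp α n m := by
  rw [displacedNumberAmp, mul_div_cancel₀ _ (sqrt_succ_ne_zero n)]

/-- `(a - α) D(α)|n⟩ = √n D(α)|n-1⟩`. -/
theorem displacedNumberAmp_lower (α : ℂ) (n m : ℕ) :
    (Real.sqrt ((m : ℝ) + 1) : ℂ) * displacedNumberAmp α n (m + 1) - α * displacedNumberAmp α n m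
      = (Real.sqrt n : ℂ) * displacedNumberAmp α (n - 1) m := by
  induction n generalizing m with
  | zero =>
    have hs : (Real.sqrt (Nat.factorial m) : ℂ) ≠ 0 := by
      rw [Complex.ofReal_ne_zero]
      exact (Real.sqrt_pos.2 (by exact_mod_cast Nat.factorial_pos m)).ne'
    have e : Real.sqrt (Nat.factorial (m + 1)) =
        Real.sqrt ((m : ℝ) + 1) * Real.sqrt (Nat.factorial m) := by
      rw [Nat.factorial_succ, Nat.cast_mul, Real.sqrt_mul (by positivity)]
      push_cast; rfl
    have := sqrt_succ_ne_zero m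
    simp only [displacedNumberAmp, e, Complex.ofReal_mul, Nat.cast_zero, Real.sqrt_zero,
      Complex.ofReal_zero, zero_mul]
    field_simp
    ring
  | succ n ih =>
    have hn := sqrt_succ_ne_zero n
    have h1 := displacedNumberAmp_succ α n (m + 1)
    have h2 := displacedNumberAmp_succ α n m
    have h3 := ih m
    have h4 : (Real.sqrt ((m : ℝ) + 1) : ℂ) * (Real.sqrt ((m : ℝ) + 1) : ℂ) = m + 1 := by
      have := sqrt_mul_self_cast (m + 1); push_cast at this ⊢; exact this
    have h5 : (Real.sqrt ((n : ℝ) + 1) : ℂ) * (Real.sqrt ((n : ℝ) + 1) : ℂ) = n + 1 := by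
      have := sqrt_mul_self_cast (n + 1); push_cast at this ⊢; exact this
    have key : (m : ℂ) * displacedNumberAmp α n m
          - α * ((Real.sqrt m : ℂ) * displacedNumberAmp α n (m - 1))
        = (Real.sqrt n : ℂ) * ((Real.sqrt m : ℂ) * displacedNumberAmp α (n - 1) (m - 1)) := by
      rcases m with _ | m
      · simp
      · have h := ih m
        have h6 := sqrt_mul_self_cast (m + 1)
        simp only [Nat.add_sub_cancel]
        push_cast at h6 ⊢
        linear_combination (Real.sqrt ((m : ℝ) + 1) : ℂ) * h
          - displacedNumberAmp α n (m + 1) * h6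
    have key2 : (Real.sqrt n : ℂ) * ((Real.sqrt m : ℂ) * displacedNumberAmp α (n - 1) (m - 1))
        = (n : ℂ) * displacedNumberAmp α n m
          + conj α * ((Real.sqrt n : ℂ) * displacedNumberAmp α (n - 1) m) := by
      rcases n with _ | n
      · simp
      · have h := displacedNumberAmp_succ α n m
        have h6 := sqrt_mul_self_cast (n + 1)
        simp only [Nat.add_sub_cancel]
        push_cast at h6 ⊢
        linear_combination (-(Real.sqrt ((n : ℝ) + 1) : ℂ)) * h
          + displacedNumberAmp α (n + 1) m * h6
    simp only [Nat.add_sub_cancel, Nat.cast_add, Nat.cast_one] at h1 h2 ⊢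
    apply mul_left_cancel₀ hn
    linear_combination (Real.sqrt ((m : ℝ) + 1) : ℂ) * h1 - α * h2 - conj α * h3 + key + key2
      + displacedNumberAmp α n m * h4 - displacedNumberAmp α n m * h5

theorem memlp_displacedNumberAmp (α : ℂ) (n : ℕ) : Memℓp (displacedNumberAmp α n) 2 := by
  have h := fastDecay_displacedNumberAmp α n
  apply memℓp_gen
  have := (h.summable_mul h).norm
  refine this.congr fun m => ?_
  simp [sq]

/-- The displaced number state `D(α)|n⟩` as a vector of the Fock space. -/
noncomputable def displacedNumber (α : ℂ) (n : ℕ) : Fock :=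
  ⟨displacedNumberAmp α n, memlp_displacedNumberAmp α n⟩

theorem inner_displacedNumber (α : ℂ) (n n' : ℕ) :
    inner ℂ (displacedNumber α n) (displacedNumber α n')
      = ∑' m, conj (displacedNumberAmp α n m) * displacedNumberAmp α n' m := by
  rw [lp.inner_eq_tsum]
  congr 1; funext m
  rw [RCLike.inner_apply, mul_comm]; rfl

theorem inner_displacedNumber_succ (α : ℂ) (n n' : ℕ) :
    (Real.sqrt ((n' : ℝ) + 1) : ℂ) *
        inner ℂ (displacedNumber α n) (displacedNumber α (n' + 1))
      = (Real.sqrt n : ℂ) * inner ℂ (displacedNumber α (n - 1)) (displacedNumber α n') := by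
  have hx := fastDecay_displacedNumberAmp α n
  have hy := fastDecay_displacedNumberAmp α n'
  rw [inner_displacedNumber, inner_displacedNumber, ← tsum_mul_left, ← tsum_mul_left]
  calc ∑' m, (Real.sqrt ((n' : ℝ) + 1) : ℂ) *
        (conj (displacedNumberAmp α n m) * displacedNumberAmp α (n' + 1) m)
      = ∑' m, (conj (displacedNumberAmp α n m) *
            ((Real.sqrt m : ℂ) * displacedNumberAmp α n' (m - 1))
          - conj (displacedNumberAmp α n m) * (conj α * displacedNumberAmp α n' m)) := by
        congr 1; funext m
        have := displacedNumberAmp_succ α n' m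
        linear_combination conj (displacedNumberAmp α n m) * this
    _ = ∑' m : ℕ, (conj ((Real.sqrt ((m : ℝ) + 1) : ℂ) * displacedNumberAmp α n (m + 1)) *
            displacedNumberAmp α n' m
          - conj (displacedNumberAmp α n m) * (conj α * displacedNumberAmp α n' m)) := by
        rw [(hx.summable_mul hy.raise).tsum_sub (hx.summable_mul (hy.const_mul _)),
          (hx.lower.summable_mul hy).tsum_sub (hx.summable_mul (hy.const_mul _)),
          tsum_raise hx hy]
    _ = _ := by
        congr 1; funext m
        have := congrArg conj (displacedNumberAmp_lower α n m)
        simp only [map_sub, map_mul, Complex.conj_ofReal] at this ⊢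
        linear_combination displacedNumberAmp α n' m * this

theorem inner_displacedNumber_zero (α : ℂ) :
    inner ℂ (displacedNumber α 0) (displacedNumber α 0) = 1 := by
  rw [inner_displacedNumber]
  have h : ∀ m : ℕ, conj (displacedNumberAmp α 0 m) * displacedNumberAmp α 0 m
      = ((Real.exp (-‖α‖ ^ 2) * ((‖α‖ ^ 2) ^ m / Nat.factorial m) : ℝ) : ℂ) := by
    intro m
    have hs : (0 : ℝ) ≤ Nat.factorial m := by positivity
    have he : Real.exp (-‖α‖ ^ 2 / 2) ^ 2 = Real.exp (-‖α‖ ^ 2) := by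
      rw [← Real.exp_nat_mul]; congr 1; push_cast; ring
    rw [mul_comm, Complex.mul_conj, Complex.normSq_eq_norm_sq, displacedNumberAmp, norm_div,
      norm_mul, Complex.norm_real, Complex.norm_real, norm_pow,
      Real.norm_of_nonneg (Real.exp_pos _).le, Real.norm_of_nonneg (Real.sqrt_nonneg _),
      div_pow, mul_pow, Real.sq_sqrt hs, he]
    congr 1; ring
  simp_rw [h]
  rw [← Complex.ofReal_tsum, tsum_mul_left]
  have := (NormedSpace.expSeries_div_hasSum_exp (𝔸 := ℝ) (‖α‖ ^ 2)).tsum_eq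
  rw [this, ← Real.exp_eq_exp_ℝ, ← Real.exp_add]
  simp

theorem inner_displacedNumber_eq (α : ℂ) (n n' : ℕ) :
    inner ℂ (displacedNumber α n) (displacedNumber α n') = if n = n' then 1 else 0 := by
  induction n' generalizing n with
  | zero =>
    rcases n with _ | n
    · simpa using inner_displacedNumber_zero α
    · have h := inner_displacedNumber_succ α 0 n
      simp only [Nat.cast_zero, Real.sqrt_zero, Complex.ofReal_zero, zero_mul, mul_eq_zero,
        sqrt_succ_ne_zero, false_or] at h
      rw [← inner_conj_symm, h]
      simp
  | succ n' ih =>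
    have h := inner_displacedNumber_succ α n n'
    apply mul_left_cancel₀ (sqrt_succ_ne_zero n')
    rw [h, ih]
    rcases n with _ | n
    · simp
    · by_cases hn : n = n'
      · subst hn; simp
      · simp [hn]

theorem orthonormal_displacedNumber (α : ℂ) : Orthonormal ℂ (displacedNumber α) :=
  orthonormal_iff_ite.2 (inner_displacedNumber_eq α)

/-- The displacement operator `D(α)`: the linear isometry that sends each number state `|n⟩` to the
displaced number state `D(α)|n⟩`. -/
noncomputable def displacement (α : ℂ) : Fock →ₗᵢ[ℂ] Fock :=
  (orthonormal_displacedNumber α).orthogonalFamily.linearIsometry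

theorem displacement_single (α : ℂ) (n : ℕ) :
    displacement α (lp.single 2 n 1) = displacedNumber α n := by
  simp [displacement]

end Displacement

/-- The thermal state `τ_N = ∑ₙ N^n / (N+1)^(n+1) |n⟩⟨n|` with mean photon number `N`
(the vacuum for `N = 0`). -/
noncomputable def thermal (N : ℝ) : Fock →L[ℂ] Fock :=
  ∑' n : ℕ, ((N ^ n / (N + 1) ^ (n + 1) : ℝ) : ℂ) •
    InnerProductSpace.rankOne ℂ (lp.single 2 n 1 : Fock) (lp.single 2 n 1 : Fock)

/-- The displaced thermal state `S_N(α) = D(α) τ_N D(α)†`. -/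
noncomputable def displacedThermal (N : ℝ) (α : ℂ) : Fock →L[ℂ] Fock :=
  (displacement α).toContinuousLinearMap ∘L thermal N ∘L
    ContinuousLinearMap.adjoint (displacement α).toContinuousLinearMap

section Tensor

variable {k : ℕ}

theorem memlp_slice (ψ : FockK k) (i : Fin k) (n : Fin k → ℕ) :
    Memℓp (fun m : ℕ => ψ (Function.update n i m)) 2 := by
  have h := (lp.memℓp ψ).summable (by simp)
  exact memℓp_gen (h.comp_injective (Function.update_injective n i))

/-- The vector of the `i`-th mode obtained from `ψ` by fixing the photon numbers of all other modes
to those in `n`. -/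
noncomputable def slice (i : Fin k) (n : Fin k → ℕ) : FockK k →ₗ[ℂ] Fock where
  toFun ψ := ⟨fun m => ψ (Function.update n i m), memlp_slice ψ i n⟩
  map_add' _ _ := rfl
  map_smul' _ _ := rfl

theorem slice_apply (i : Fin k) (n : Fin k → ℕ) (ψ : FockK k) (m : ℕ) :
    slice i n ψ m = ψ (Function.update n i m) := rfl

theorem enorm_sq_tsum {ι : Type*} (x : lp (fun _ : ι => ℂ) 2) :
    ∑' i, ENNReal.ofReal (‖x i‖ ^ 2) = ENNReal.ofReal (‖x‖ ^ 2) := by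
  have h := lp.hasSum_norm (p := 2) (by simp) x
  simp only [ENNReal.toReal_ofNat, Real.rpow_ofNat] at h
  rw [← h.tsum_eq, ENNReal.ofReal_tsum_of_nonneg (fun _ => by positivity) h.summable]

theorem tsum_update (i : Fin k) (f : (Fin k → ℕ) → ENNReal) :
    ∑' n, f n = ∑' (r : {j : Fin k // j ≠ i} → ℕ) (m : ℕ),
      f ((Equiv.funSplitAt i ℕ).symm (m, r)) := by
  rw [← (Equiv.funSplitAt i ℕ).symm.tsum_eq f, ENNReal.tsum_comm]
  exact ENNReal.tsum_prod (f := fun m r => f ((Equiv.funSplitAt i ℕ).symm (m, r)))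

theorem update_funSplitAt (i : Fin k) (m m' : ℕ) (r : {j : Fin k // j ≠ i} → ℕ) :
    Function.update ((Equiv.funSplitAt i ℕ).symm (m, r)) i m' =
      (Equiv.funSplitAt i ℕ).symm (m', r) := by
  funext j
  by_cases h : j = i
  · subst h; simp [Equiv.funSplitAt, Equiv.piSplitAt]
  · simp [Equiv.funSplitAt, Equiv.piSplitAt, h]

theorem tsum_ampliation_le (i : Fin k) (A : Fock →L[ℂ] Fock) (ψ : FockK k) :
    ∑' n : Fin k → ℕ, ENNReal.ofReal (‖A (slice i n ψ) (n i)‖ ^ 2)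
      ≤ ENNReal.ofReal ((‖A‖ * ‖ψ‖) ^ 2) := by
  rw [tsum_update i, mul_pow, ENNReal.ofReal_mul (by positivity), ← enorm_sq_tsum ψ,
    tsum_update i, ← ENNReal.tsum_mul_left]
  refine ENNReal.tsum_le_tsum fun r => ?_
  have hs : ∀ m : ℕ, slice i ((Equiv.funSplitAt i ℕ).symm (m, r)) ψ
      = slice i ((Equiv.funSplitAt i ℕ).symm (0, r)) ψ := by
    intro m
    apply lp.ext
    funext m'
    rw [slice_apply, slice_apply, update_funSplitAt, update_funSplitAt]
  have hi : ∀ m : ℕ, (Equiv.funSplitAt i ℕ).symm (m, r) i = m := by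
    intro m; simp [Equiv.funSplitAt, Equiv.piSplitAt]
  simp_rw [hi, hs]
  rw [enorm_sq_tsum]
  have h2 : ∑' m : ℕ, ENNReal.ofReal (‖ψ ((Equiv.funSplitAt i ℕ).symm (m, r))‖ ^ 2)
      = ENNReal.ofReal (‖slice i ((Equiv.funSplitAt i ℕ).symm (0, r)) ψ‖ ^ 2) := by
    rw [← enorm_sq_tsum]
    refine tsum_congr fun m => ?_
    rw [slice_apply, update_funSplitAt]
  rw [h2, ← ENNReal.ofReal_mul (by positivity), ← mul_pow]
  exact ENNReal.ofReal_le_ofReal (by gcongr; exact A.le_opNorm _)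

theorem summable_ampliation (i : Fin k) (A : Fock →L[ℂ] Fock) (ψ : FockK k) :
    Summable (fun n : Fin k → ℕ => ‖A (slice i n ψ) (n i)‖ ^ 2) := by
  have h := ne_top_of_le_ne_top ENNReal.ofReal_ne_top (tsum_ampliation_le i A ψ)
  have := ENNReal.summable_toReal h
  refine this.congr fun n => ?_
  rw [ENNReal.toReal_ofReal (by positivity)]

theorem memlp_ampliation (i : Fin k) (A : Fock →L[ℂ] Fock) (ψ : FockK k) :
    Memℓp (fun n : Fin k → ℕ => A (slice i n ψ) (n i)) 2 :=
  memℓp_gen (by simpa using summable_ampliation i A ψ)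

/-- The operator `1 ⊗ ⋯ ⊗ A ⊗ ⋯ ⊗ 1` that acts as `A` on the `i`-th mode. -/
noncomputable def ampliation (i : Fin k) (A : Fock →L[ℂ] Fock) : FockK k →L[ℂ] FockK k :=
  LinearMap.mkContinuous
    { toFun := fun ψ => ⟨fun n => A (slice i n ψ) (n i), memlp_ampliation i A ψ⟩
      map_add' := fun ψ φ => by
        apply lp.ext; funext n
        simp only [map_add]; rfl
      map_smul' := fun c ψ => by
        apply lp.ext; funext n
        simp only [map_smul]; rfl }
    ‖A‖ (fun ψ => by
      have h := tsum_ampliation_le i A ψ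
      rw [← abs_of_nonneg (norm_nonneg _), ← abs_of_nonneg (by positivity : 0 ≤ ‖A‖ * ‖ψ‖)]
      apply sq_le_sq.1
      rw [← ENNReal.ofReal_le_ofReal_iff (by positivity), ← enorm_sq_tsum]
      exact h)

theorem ampliation_apply (i : Fin k) (A : Fock →L[ℂ] Fock) (ψ : FockK k) (n : Fin k → ℕ) :
    ampliation i A ψ n = A (slice i n ψ) (n i) := rfl

/-- The tensor product operator `A₁ ⊗ ⋯ ⊗ A_k`, the product of the (commuting) operators `A_i`
acting on the `i`-th mode. -/
noncomputable def tensorOp (A : Fin k → (Fock →L[ℂ] Fock)) : FockK k →L[ℂ] FockK k :=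
  (List.ofFn fun i => ampliation i (A i)).prod

theorem ampliation_product (i : Fin k) (A : Fock →L[ℂ] Fock) (v : Fin k → Fock) (ψ : FockK k)
    (hψ : ∀ n, ψ n = ∏ j, v j (n j)) (n : Fin k → ℕ) :
    ampliation i A ψ n = ∏ j, Function.update v i (A (v i)) j (n j) := by
  have h : slice i n ψ = (∏ j ∈ Finset.univ.erase i, v j (n j)) • v i := by
    apply lp.ext; funext m
    rw [slice_apply, hψ, lp.coeFn_smul, Pi.smul_apply, smul_eq_mul,
      ← Finset.mul_prod_erase _ _ (Finset.mem_univ i), Function.update_self, mul_comm]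
    congr 1
    refine Finset.prod_congr rfl fun j hj => ?_
    rw [Function.update_of_ne (Finset.ne_of_mem_erase hj)]
  rw [ampliation_apply, h, map_smul, lp.coeFn_smul, Pi.smul_apply, smul_eq_mul,
    ← Finset.mul_prod_erase _ _ (Finset.mem_univ i), Function.update_self, mul_comm]
  congr 1
  refine Finset.prod_congr rfl fun j hj => ?_
  rw [Function.update_of_ne (Finset.ne_of_mem_erase hj)]

/-- `(A₁ ⊗ ⋯ ⊗ A_k) (v₁ ⊗ ⋯ ⊗ v_k) = A₁ v₁ ⊗ ⋯ ⊗ A_k v_k`. -/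
theorem tensorOp_product (A : Fin k → (Fock →L[ℂ] Fock)) (v : Fin k → Fock) (ψ : FockK k)
    (hψ : ∀ n, ψ n = ∏ j, v j (n j)) (n : Fin k → ℕ) :
    tensorOp A ψ n = ∏ j, A j (v j) (n j) := by
  have key : ∀ l : List (Fin k), l.Nodup → ∀ n,
      (l.map fun i => ampliation i (A i)).prod ψ n
        = ∏ j, (if j ∈ l then A j (v j) else v j) (n j) := by
    intro l
    induction l with
    | nil => intro _ n; simpa using hψ n
    | cons i l ih =>
      intro hl n
      rw [List.nodup_cons] at hl
      rw [List.map_cons, List.prod_cons, mul_apply_eq_comp,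
        ampliation_product i (A i) _ _ (ih hl.2) n]
      refine Finset.prod_congr rfl fun j _ => ?_
      by_cases hj : j = i
      · subst hj; simp [hl.1]
      · simp [hj]
  have h := key (List.finRange k) (List.nodup_finRange k) n
  simpa [tensorOp, List.ofFn_eq_map] using h

end Tensor

/-- The `k`-mode displaced thermal state `S_N^k(α) = S_N(α₁) ⊗ ⋯ ⊗ S_N(α_k)`. -/
noncomputable def displacedThermalK {k : ℕ} (N : ℝ) (α : EuclideanSpace ℂ (Fin k)) :
    FockK k →L[ℂ] FockK k :=
  tensorOp fun i => displacedThermal N (α i)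

/-- The trace of an operator on the `k`-mode Fock space, computed in the number basis. -/
noncomputable def trace {k : ℕ} (T : FockK k →L[ℂ] FockK k) : ℂ :=
  ∑' n : Fin k → ℕ, inner ℂ (lp.single 2 n 1 : FockK k) (T (lp.single 2 n 1))

/-- A `(k, M, lam1, lam2)` deterministic multi-user identification scheme with noise photon number
`N` and energy bound `E`: amplitude vectors `α_m ∈ ℂ^k` of coherent-state signatures
`|α_{m,1}⟩ ⊗ ⋯ ⊗ |α_{m,k}⟩` with `‖α_m‖² ≤ k E`, and binary tests `{Π_m, 1 - Π_m}` with
`0 ≤ Π_m ≤ 1`, with errors of the first and second kind at most `lam1` and `lam2`. -/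
structure IDScheme (k M : ℕ) (N E lam1 lam2 : ℝ) where
  signature : Fin M → EuclideanSpace ℂ (Fin k)
  energy : ∀ m, ‖signature m‖ ^ 2 ≤ k * E
  test : Fin M → (FockK k →L[ℂ] FockK k)
  test_nonneg : ∀ m, 0 ≤ test m
  test_le_one : ∀ m, test m ≤ 1
  first_kind : ∀ m, 1 - (trace (displacedThermalK N (signature m) * test m)).re ≤ lam1
  second_kind : ∀ m m', m' ≠ m →
    (trace (displacedThermalK N (signature m') * test m)).re ≤ lam2

end BosonicID

/-! The argument is a sphere packing bound in `ℂ^k = ℝ^{2k}`: the tests force the signatures apart,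
the energy bound keeps them in a ball of radius `√(kE)`, and comparing volumes limits their number.

For the separation, write two states as `ρ = F F†` and `σ = G G†` and consider the overlap `tr F†G =
∑ₙ ⟨F eₙ, G eₙ⟩`. A test `P` accepting `ρ` and rejecting `σ` with errors at most `δ` splits it into
`tr F†PG + tr F†(1-P)G`. By Cauchy–Schwarz each term is at most `√δ`, so the overlap is at most
`2√δ` (`norm_tsum_inner_le_of_test`).

On the other hand, displaced thermal states at distance `|α - β|` have factors with overlap at least
`exp(-2|α - β|²/(2N+1))` in each mode (`exists_factor`). Two choices of factors are needed. For `N ≤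
1/2`, take `D(α)√τ` and `D(β)√τ`. The overlap is, up to a phase, `tr τ D(β - α)`, the characteristic
function of the thermal state, of modulus `exp(-(N + 1/2)|α - β|²)`; it comes from the Laguerre
generating function. This becomes too small for large `N`. For `N ≥ 1/2`, replace the second factor
by `√S_N(β) D(α)`, so that the overlap is `tr √S_N(α)√S_N(β)`. Since `√τ` is an exponential in the
photon number, which has mean `n + |α - β|²` in `D(α - β)|n⟩`, Jensen's inequality gives at least
`exp(-|α - β|²/(2N))`.

Overlaps multiply over the modes, so `exp(-2‖α - β‖²/(2N+1)) ≤ 2√δ` for distinct signatures, which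
is the separation (`IDScheme.signature_separated`). -/

namespace BosonicID

/-! ### Tools: traces, positive operators, product sums and sphere packing. -/

section General

variable {ι : Type*}

theorem _root_.HasSum.congr_of_eq {R : Type*} [AddCommMonoid R] [TopologicalSpace R]
    {f g : ι → R} {a : R} (h : HasSum f a) (e : ∀ i, g i = f i) :
    HasSum g a := by
  rwa [funext e]

theorem hasSum_norm_sq (x : lp (fun _ : ι => ℂ) 2) :
    HasSum (fun i => ‖x i‖ ^ 2) (‖x‖ ^ 2) := by
  have h := lp.hasSum_norm (p := 2) (by simp) x
  simpa using h

theorem hasSum_conj_mul (x y : lp (fun _ : ι => ℂ) 2) :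
    HasSum (fun i => conj (x i) * y i) (inner ℂ x y) := by
  have h := lp.hasSum_inner (𝕜 := ℂ) x y
  refine h.congr_of_eq fun i => ?_
  rw [RCLike.inner_apply, mul_comm]

variable [DecidableEq ι]

theorem clm_ext_single {H : Type*} [NormedAddCommGroup H] [NormedSpace ℂ H]
    {A B : lp (fun _ : ι => ℂ) 2 →L[ℂ] H}
    (h : ∀ i, A (lp.single 2 i 1) = B (lp.single 2 i 1)) : A = B := by
  ext x
  have hx := lp.hasSum_single (by simp) x
  have e : ∀ i, lp.single 2 i (x i) = x i • (lp.single 2 i 1 : lp (fun _ : ι => ℂ) 2) := by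
    intro i
    rw [← lp.single_smul, smul_eq_mul, mul_one]
  have hA := hx.mapL A
  have hB := hx.mapL B
  refine hA.unique ?_
  convert hB using 2 with i
  rw [e, map_smul, map_smul, h]

theorem inner_single_one (i : ι) (x : lp (fun _ : ι => ℂ) 2) :
    inner ℂ (lp.single 2 i 1) x = x i := by
  rw [lp.inner_single_left]; simp

/-- Cyclicity of the trace for `F F† T` with `F` Hilbert–Schmidt. -/
theorem hasSum_inner_comp_adjoint (F T : lp (fun _ : ι => ℂ) 2 →L[ℂ] lp (fun _ : ι => ℂ) 2)
    (hF : Summable fun i => ‖F (lp.single 2 i 1)‖ ^ 2) :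
    HasSum (fun i => inner ℂ (F (lp.single 2 i 1)) (T (F (lp.single 2 i 1))))
      (∑' e, inner ℂ (lp.single 2 e 1 : lp (fun _ : ι => ℂ) 2)
        ((F ∘L ContinuousLinearMap.adjoint F) (T (lp.single 2 e 1)))) := by
  set E : ι → lp (fun _ : ι => ℂ) 2 := fun i => lp.single 2 i 1 with hE
  let S := ContinuousLinearMap.adjoint T
  -- Summing `g (i, e)` over `e` gives a summand of `tr F†TF`; summing over `i` gives a summand of
  -- `tr FF†T`. The claim is Fubini for `g`.
  let g : ι × ι → ℂ := fun p => F (E p.1) p.2 * conj (S (F (E p.1)) p.2)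
  have hrow : ∀ i, HasSum (fun e => g (i, e)) (inner ℂ (F (E i)) (T (F (E i)))) := by
    intro i
    have h := hasSum_conj_mul (S (F (E i))) (F (E i))
    rw [ContinuousLinearMap.adjoint_inner_left] at h
    convert h using 2 with e
    exact mul_comm _ _
  have hcol : ∀ e, HasSum (fun i => g (i, e))
      (inner ℂ (E e) ((F ∘L ContinuousLinearMap.adjoint F) (T (E e)))) := by
    intro e
    have h := hasSum_conj_mul (ContinuousLinearMap.adjoint F (E e))
      (ContinuousLinearMap.adjoint F (T (E e)))
    rw [ContinuousLinearMap.adjoint_inner_left] at h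
    refine h.congr_of_eq fun i => ?_
    rw [← inner_single_one i, ← inner_single_one i, ContinuousLinearMap.adjoint_inner_right,
      ContinuousLinearMap.adjoint_inner_right, inner_conj_symm]
    change F (E i) e * conj (S (F (E i)) e) = _
    rw [← inner_single_one e (F (E i)), ← inner_single_one e (S (F (E i))), inner_conj_symm,
      ContinuousLinearMap.adjoint_inner_left]
  -- The majorant adds the squared Hilbert–Schmidt norms of `F` and `T†F`, the latter finite because
  -- `T` is bounded.
  have hdom : Summable fun p : ι × ι => (‖F (E p.1) p.2‖ ^ 2 + ‖S (F (E p.1)) p.2‖ ^ 2) := by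
    have hr : ∀ i, HasSum (fun e => ‖F (E i) e‖ ^ 2 + ‖S (F (E i)) e‖ ^ 2)
        (‖F (E i)‖ ^ 2 + ‖S (F (E i))‖ ^ 2) := fun i =>
      (hasSum_norm_sq _).add (hasSum_norm_sq _)
    rw [summable_prod_of_nonneg (fun p => by positivity)]
    refine ⟨fun i => (hr i).summable, ?_⟩
    simp only [(hr _).tsum_eq]
    refine Summable.of_nonneg_of_le (fun i => by positivity) (fun i => ?_)
      (hF.mul_left (1 + ‖S‖ ^ 2))
    have := S.le_opNorm (F (E i))
    calc _ ≤ ‖F (E i)‖ ^ 2 + (‖S‖ * ‖F (E i)‖) ^ 2 := by gcongr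
      _ = _ := by ring
  have hg : Summable g := by
    refine Summable.of_norm_bounded hdom fun p => ?_
    rw [norm_mul, RCLike.norm_conj]
    nlinarith [sq_nonneg (‖F (E p.1) p.2‖ - ‖S (F (E p.1)) p.2‖),
      sq_nonneg (‖F (E p.1) p.2‖ + ‖S (F (E p.1)) p.2‖)]
  have h1 := hg.hasSum.prod_fiberwise hrow
  have h2 := ((Equiv.prodComm ι ι).hasSum_iff.2 hg.hasSum).prod_fiberwise hcol
  rw [h2.tsum_eq]
  exact h1

end General

/-- Cauchy–Schwarz for the form of `P`, in its weighted arithmetic-mean form: the right side is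
linear in the quadratic forms, so it can be summed over a basis with one fixed weight `r`. -/
theorem norm_inner_le_of_nonneg {H : Type*} [NormedAddCommGroup H] [InnerProductSpace ℂ H]
    {P : H →L[ℂ] H} (hP : 0 ≤ P) (x y : H) {r : ℝ} (hr : 0 < r) :
    2 * ‖inner ℂ x (P y)‖ ≤ r * (inner ℂ x (P x)).re + (inner ℂ y (P y)).re / r := by
  have hP' : P.IsPositive := by simpa using (ContinuousLinearMap.le_def 0 P).1 hP
  -- The phase `w` makes the cross term real and nonnegative; the bound is then positivity of `P` at
  -- `r x - w y`.
  obtain ⟨w, hw, hwz⟩ : ∃ w : ℂ, ‖w‖ = 1 ∧ w * inner ℂ x (P y) = (‖inner ℂ x (P y)‖ : ℂ) := by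
    by_cases hz : inner ℂ x (P y) = 0
    · exact ⟨1, by simp, by simp [hz]⟩
    · have hn : (‖inner ℂ x (P y)‖ : ℂ) ≠ 0 := by simpa using hz
      refine ⟨conj (inner ℂ x (P y)) / ‖inner ℂ x (P y)‖, ?_, ?_⟩
      · rw [norm_div, RCLike.norm_conj, Complex.norm_real, norm_norm, div_self]
        simpa using hz
      · rw [div_mul_eq_mul_div, Complex.conj_mul', sq, mul_div_assoc, div_self hn, mul_one]
  have h := hP'.re_inner_nonneg_right ((r : ℂ) • x - w • y)
  have hsym : inner ℂ y (P x) = conj (inner ℂ x (P y)) := by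
    rw [inner_conj_symm, hP'.inner_left_eq_inner_right]
  have hww : conj w * w = 1 := by rw [Complex.conj_mul', hw]; simp
  have e : inner ℂ ((r : ℂ) • x - w • y) (P ((r : ℂ) • x - w • y))
      = (r : ℂ) ^ 2 * inner ℂ x (P x) + inner ℂ y (P y)
        - r * (w * inner ℂ x (P y) + conj (w * inner ℂ x (P y))) := by
    simp only [map_sub, map_smul, inner_sub_left, inner_sub_right, inner_smul_left,
      inner_smul_right, hsym, map_mul, Complex.conj_ofReal]
    linear_combination inner ℂ y (P y) * hww
  rw [e, hwz, Complex.conj_ofReal] at h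
  have h' : 0 ≤ r ^ 2 * (inner ℂ x (P x)).re + (inner ℂ y (P y)).re
      - r * (‖inner ℂ x (P y)‖ + ‖inner ℂ x (P y)‖) := by
    have e2 : ((r : ℂ) ^ 2 * inner ℂ x (P x) + inner ℂ y (P y)
        - r * ((‖inner ℂ x (P y)‖ : ℂ) + (‖inner ℂ x (P y)‖ : ℂ))).re =
        r ^ 2 * (inner ℂ x (P x)).re + (inner ℂ y (P y)).re
      - r * (‖inner ℂ x (P y)‖ + ‖inner ℂ x (P y)‖) := by
      rw [← Complex.ofReal_pow, ← Complex.ofReal_add, ← Complex.ofReal_mul, Complex.sub_re,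
        Complex.add_re, Complex.re_ofReal_mul, Complex.ofReal_re]
    rw [← e2]; exact h
  have : 2 * ‖inner ℂ x (P y)‖ * r ≤ r ^ 2 * (inner ℂ x (P x)).re + (inner ℂ y (P y)).re := by
    linarith
  rw [← le_div_iff₀ hr] at this
  refine this.trans (le_of_eq ?_)
  field_simp

theorem re_inner_nonneg {H : Type*} [NormedAddCommGroup H] [InnerProductSpace ℂ H]
    {P : H →L[ℂ] H} (hP : 0 ≤ P) (x : H) : 0 ≤ (inner ℂ x (P x)).re := by
  have hP' : P.IsPositive := by simpa using (ContinuousLinearMap.le_def 0 P).1 hP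
  exact hP'.re_inner_nonneg_right x

theorem hasSum_pi_prod {k : ℕ} (f : Fin k → ℕ → ℂ) (hf : ∀ i, Summable fun n => ‖f i n‖) :
    Summable (fun n : Fin k → ℕ => ‖∏ i, f i (n i)‖) ∧
    HasSum (fun n : Fin k → ℕ => ∏ i, f i (n i)) (∏ i, ∑' n, f i n) := by
  induction k with
  | zero => exact ⟨(hasSum_fintype _).summable, by simp⟩
  | succ k ih =>
    obtain ⟨h1, h2⟩ := ih (fun i => f i.succ) (fun i => hf _)
    have key : ∀ p : ℕ × (Fin k → ℕ),
        ∏ i, f i (Fin.consEquiv (fun _ : Fin (k + 1) => ℕ) p i)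
          = f 0 p.1 * ∏ i, f (Fin.succ i) (p.2 i) := by
      intro p
      rw [Fin.prod_univ_succ]
      simp [Fin.consEquiv]
    have hs := summable_mul_of_summable_norm (hf 0) h1
    constructor
    · rw [← (Fin.consEquiv (fun _ : Fin (k + 1) => ℕ)).summable_iff]
      refine ((hf 0).mul_norm h1).congr fun p => ?_
      rw [Function.comp_apply, key]
    · rw [← (Fin.consEquiv (fun _ : Fin (k + 1) => ℕ)).hasSum_iff, Fin.prod_univ_succ]
      have := (hf 0).of_norm.hasSum.mul h2 hs
      refine this.congr_of_eq fun p => ?_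
      exact key p

-- The balls of radius `d/2` about the points are disjoint and lie in the ball of radius `R + d/2`.
-- The ratio of volumes is `((R + d/2)/(d/2))` to the power of the dimension.
open MeasureTheory Metric in
theorem card_le_of_separated_of_norm_le {E : Type*} [NormedAddCommGroup E] [NormedSpace ℝ E]
    [FiniteDimensional ℝ E] {M : ℕ} (x : Fin M → E) {R d : ℝ} (hR : 0 ≤ R) (hd : 0 < d)
    (hx : ∀ m, ‖x m‖ ≤ R) (hsep : ∀ m m', m ≠ m' → d ≤ ‖x m - x m'‖) :
    (M : ℝ) ≤ (1 + 2 * R / d) ^ Module.finrank ℝ E := by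
  borelize E
  let μ : Measure E := Measure.addHaar
  have hd2 : 0 < d / 2 := by positivity
  have hρ : 0 < R + d / 2 := by positivity
  have D : Pairwise (Function.onFun Disjoint fun m => ball (x m) (d / 2)) := by
    intro m m' hm
    apply ball_disjoint_ball
    rw [dist_eq_norm]
    linarith [hsep m m' hm]
  have hsub : (⋃ m, ball (x m) (d / 2)) ⊆ ball (0 : E) (R + d / 2) := by
    refine Set.iUnion_subset fun m => ball_subset_ball' ?_
    rw [dist_zero_right]
    linarith [hx m]
  have I : (M : ENNReal) * ENNReal.ofReal ((d / 2) ^ Module.finrank ℝ E) * μ (ball 0 1) ≤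
      ENNReal.ofReal ((R + d / 2) ^ Module.finrank ℝ E) * μ (ball 0 1) := by
    rw [← μ.addHaar_ball_of_pos 0 hρ]
    refine le_trans (le_of_eq ?_) (measure_mono hsub)
    rw [measure_iUnion D fun m => measurableSet_ball]
    simp only [μ.addHaar_ball_of_pos _ hd2]
    simp [mul_assoc]
  have J := (ENNReal.mul_le_mul_iff_left (measure_ball_pos μ _ zero_lt_one).ne'
    measure_ball_lt_top.ne).1 I
  have K := ENNReal.toReal_le_of_le_ofReal (by positivity) J
  rw [ENNReal.toReal_mul, ENNReal.toReal_ofReal (by positivity), ENNReal.toReal_natCast,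
    ← le_div_iff₀ (by positivity), ← div_pow] at K
  refine K.trans (le_of_eq ?_)
  congr 1
  field_simp
  ring

/-! ### The thermal state and its square root as diagonal operators. -/

section Diagonal

/-- The operator `∑ₙ a n |n⟩⟨n|`. -/
noncomputable def diagOp (a : ℕ → ℝ) : Fock →L[ℂ] Fock :=
  ∑' n : ℕ, ((a n : ℝ) : ℂ) •
    InnerProductSpace.rankOne ℂ (lp.single 2 n 1 : Fock) (lp.single 2 n 1 : Fock)

theorem norm_single_one {ι : Type*} [DecidableEq ι] (i : ι) :
    ‖(lp.single 2 i 1 : lp (fun _ : ι => ℂ) 2)‖ = 1 := by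
  rw [lp.norm_single (by simp)]; simp

theorem diagOp_apply {a : ℕ → ℝ} (ha : Summable fun n => |a n|) (x : Fock) (m : ℕ) :
    diagOp a x m = a m * x m := by
  have hs : Summable fun n : ℕ => ((a n : ℝ) : ℂ) •
      InnerProductSpace.rankOne ℂ (lp.single 2 n 1 : Fock) (lp.single 2 n 1 : Fock) := by
    refine Summable.of_norm_bounded ha fun n => ?_
    rw [norm_smul, InnerProductSpace.norm_rankOne, norm_single_one]
    simp
  have h1 := hs.hasSum.mapL (ContinuousLinearMap.apply ℂ Fock x)
  have h2 := h1.mapL (innerSL ℂ (lp.single 2 m 1 : Fock))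
  have h3 : HasSum (fun n : ℕ => if n = m then (a m : ℂ) * x m else 0) ((a m : ℂ) * x m) :=
    hasSum_ite_eq m _
  have h4 := h2.unique (h3.congr_of_eq fun n => ?_)
  · rw [← h4]
    exact (inner_single_one m _).symm
  · change inner ℂ (lp.single 2 m 1 : Fock) (((a n : ℝ) : ℂ) •
      (inner ℂ (lp.single 2 n 1 : Fock) x • (lp.single 2 n 1 : Fock))) = _
    rw [inner_single_one, lp.coeFn_smul, Pi.smul_apply, lp.coeFn_smul, Pi.smul_apply,
      inner_single_one, lp.coeFn_single]
    by_cases h : n = m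
    · subst h; simp
    · simp [h, Ne.symm h]

theorem adjoint_diagOp {a : ℕ → ℝ} (ha : Summable fun n => |a n|) :
    ContinuousLinearMap.adjoint (diagOp a) = diagOp a := by
  symm
  rw [ContinuousLinearMap.eq_adjoint_iff]
  intro x y
  refine (hasSum_conj_mul _ _).unique ((hasSum_conj_mul _ _).congr_of_eq fun m => ?_)
  rw [diagOp_apply ha, diagOp_apply ha, map_mul, Complex.conj_ofReal]
  ring

/-- The weights of the thermal state. -/
noncomputable def thermalWeight (N : ℝ) (n : ℕ) : ℝ := N ^ n / (N + 1) ^ (n + 1)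

variable {N : ℝ}

theorem thermalWeight_eq (hN : 0 ≤ N) (n : ℕ) :
    thermalWeight N n = (N / (N + 1)) ^ n * (N + 1)⁻¹ := by
  rw [thermalWeight, pow_succ, div_pow]
  field_simp

theorem thermalWeight_nonneg (hN : 0 ≤ N) (n : ℕ) : 0 ≤ thermalWeight N n := by
  rw [thermalWeight]; positivity

theorem div_add_one_lt_one (hN : 0 ≤ N) : N / (N + 1) < 1 := by
  rw [div_lt_one (by positivity)]; linarith

theorem hasSum_thermalWeight (hN : 0 ≤ N) : HasSum (thermalWeight N) 1 := by
  have h := (hasSum_geometric_of_lt_one (by positivity) (div_add_one_lt_one hN)).mul_right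
    (N + 1)⁻¹
  have e : (1 - N / (N + 1))⁻¹ * (N + 1)⁻¹ = 1 := by
    have : N + 1 ≠ 0 := by positivity
    rw [← mul_inv, sub_mul, div_mul_cancel₀ _ this]; simp
  rw [e] at h
  rwa [funext (thermalWeight_eq hN)]

theorem sqrt_thermalWeight_eq (hN : 0 ≤ N) (n : ℕ) :
    Real.sqrt (thermalWeight N n) = Real.sqrt (N / (N + 1)) ^ n * Real.sqrt (N + 1)⁻¹ := by
  rw [thermalWeight_eq hN, Real.sqrt_mul (by positivity)]
  congr 1
  rw [Real.sqrt_eq_iff_mul_self_eq (by positivity) (by positivity), ← mul_pow,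
    Real.mul_self_sqrt (by positivity)]

theorem summable_abs_thermalWeight (hN : 0 ≤ N) : Summable fun n => |thermalWeight N n| :=
  (hasSum_thermalWeight hN).summable.abs

/-- The roots of the weights are again geometric, with ratio `√(N/(N+1)) < 1`, so the series
defining `thermalRoot` converges in norm. -/
theorem summable_abs_sqrt_thermalWeight (hN : 0 ≤ N) :
    Summable fun n => |Real.sqrt (thermalWeight N n)| := by
  apply Summable.abs
  rw [funext (sqrt_thermalWeight_eq hN)]
  refine (summable_geometric_of_lt_one (Real.sqrt_nonneg _) ?_).mul_right _
  rw [Real.sqrt_lt' one_pos, one_pow]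
  exact div_add_one_lt_one hN

/-- The square root of the thermal state. -/
noncomputable def thermalRoot (N : ℝ) : Fock →L[ℂ] Fock :=
  diagOp fun n => Real.sqrt (thermalWeight N n)

theorem thermalRoot_apply (hN : 0 ≤ N) (x : Fock) (m : ℕ) :
    thermalRoot N x m = (Real.sqrt (thermalWeight N m) : ℂ) * x m :=
  diagOp_apply (summable_abs_sqrt_thermalWeight hN) x m

theorem adjoint_thermalRoot (hN : 0 ≤ N) :
    ContinuousLinearMap.adjoint (thermalRoot N) = thermalRoot N :=
  adjoint_diagOp (summable_abs_sqrt_thermalWeight hN)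

theorem thermalRoot_comp_self (hN : 0 ≤ N) : thermalRoot N ∘L thermalRoot N = thermal N := by
  refine ContinuousLinearMap.ext fun x => lp.ext (funext fun m => ?_)
  -- `thermal N` unfolds to `diagOp (thermalWeight N)`.
  have h : thermal N x m = (thermalWeight N m : ℂ) * x m :=
    diagOp_apply (summable_abs_thermalWeight hN) x m
  rw [ContinuousLinearMap.comp_apply, thermalRoot_apply hN, thermalRoot_apply hN, h, ← mul_assoc,
    ← Complex.ofReal_mul, Real.mul_self_sqrt (thermalWeight_nonneg hN m)]

theorem thermalRoot_single (hN : 0 ≤ N) (n : ℕ) :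
    thermalRoot N (lp.single 2 n 1) = (Real.sqrt (thermalWeight N n) : ℂ) • lp.single 2 n 1 := by
  refine lp.ext (funext fun m => ?_)
  rw [thermalRoot_apply hN, lp.coeFn_smul, Pi.smul_apply, lp.coeFn_single, smul_eq_mul]
  by_cases h : m = n
  · subst h; rfl
  · simp [h]

end Diagonal

/-! ### Unitarity of displacements and ladder relations for their matrix elements. -/

section DisplacementInner

/-- The displacement operator as a bounded operator. -/
noncomputable def displacementL (α : ℂ) : Fock →L[ℂ] Fock :=
  (displacement α).toContinuousLinearMap

theorem displacementL_single (α : ℂ) (n : ℕ) :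
    displacementL α (lp.single 2 n 1) = displacedNumber α n := displacement_single α n

theorem displacedNumberAmp_zero_right (α : ℂ) (n : ℕ) :
    displacedNumberAmp α n 0 =
      (Real.exp (-‖α‖ ^ 2 / 2) : ℂ) * (-conj α) ^ n / (Real.sqrt (Nat.factorial n) : ℂ) := by
  induction n with
  | zero => simp [displacedNumberAmp]
  | succ n ih =>
    have e : Real.sqrt (Nat.factorial (n + 1)) =
        Real.sqrt ((n : ℝ) + 1) * Real.sqrt (Nat.factorial n) := by
      rw [Nat.factorial_succ, Nat.cast_mul, Real.sqrt_mul (by positivity)]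
      push_cast; rfl
    have hs : (Real.sqrt (Nat.factorial n) : ℂ) ≠ 0 := by
      rw [Complex.ofReal_ne_zero]
      exact (Real.sqrt_pos.2 (by exact_mod_cast Nat.factorial_pos n)).ne'
    have := sqrt_succ_ne_zero n
    rw [displacedNumberAmp, ih, e]
    push_cast
    field_simp
    simp only [Real.sqrt_zero, Complex.ofReal_zero]
    ring

/-- `⟨n|D(α)|m⟩* = ⟨m|D(-α)|n⟩`. -/
theorem conj_displacedNumberAmp (α : ℂ) (n m : ℕ) :
    conj (displacedNumberAmp α m n) = displacedNumberAmp (-α) n m := by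
  induction n generalizing m with
  | zero =>
    rw [displacedNumberAmp_zero_right, displacedNumberAmp]
    simp only [map_div₀, map_mul, map_pow, map_neg, Complex.conj_ofReal, Complex.conj_conj,
      norm_neg]
  | succ n ih =>
    apply mul_left_cancel₀ (sqrt_succ_ne_zero n)
    rw [displacedNumberAmp_succ, ← ih, ← ih]
    -- The conjugated lowering relation for `α` is the raising recursion for `-α` with the two
    -- indices exchanged.
    have h := congrArg conj (displacedNumberAmp_lower α m n)
    simp only [map_sub, map_mul, Complex.conj_ofReal, map_neg] at h ⊢
    linear_combination h

theorem adjoint_displacementL (α : ℂ) :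
    ContinuousLinearMap.adjoint (displacementL α) = displacementL (-α) := by
  refine clm_ext_single fun n => lp.ext (funext fun m => ?_)
  rw [← inner_single_one m, ContinuousLinearMap.adjoint_inner_right, displacementL_single,
    displacementL_single, ← inner_conj_symm, inner_single_one]
  exact conj_displacedNumberAmp α n m

theorem adjoint_comp_displacementL (α : ℂ) :
    ContinuousLinearMap.adjoint (displacementL α) ∘L displacementL α = 1 :=
  (displacementL α).norm_map_iff_adjoint_comp_self.1 (displacement α).norm_map

/-- Surjectivity is not built into `displacement`; it follows because the adjoint `D(-α)` is an
isometry too. -/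
theorem displacementL_comp_adjoint (α : ℂ) :
    displacementL α ∘L ContinuousLinearMap.adjoint (displacementL α) = 1 := by
  have h := adjoint_comp_displacementL (-α)
  rwa [← adjoint_displacementL, ContinuousLinearMap.adjoint_adjoint] at h

variable (α β : ℂ)

theorem inner_displacedNumber_tsum (n m : ℕ) :
    inner ℂ (displacedNumber α n) (displacedNumber β m)
      = ∑' j, conj (displacedNumberAmp α n j) * displacedNumberAmp β m j :=
  ((hasSum_conj_mul (displacedNumber α n) (displacedNumber β m)).tsum_eq).symm

/-- Write `√(m+1) D(β)|m+1⟩ = (a† - conj β) D(β)|m⟩` and move `a†` to the left vector, where `a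
D(α)|n⟩ = α D(α)|n⟩ + √n D(α)|n-1⟩`. For `n = 0` the truncated index is harmless, as its coefficient
vanishes. -/
theorem inner_displacedNumber_succ_right (n m : ℕ) :
    (Real.sqrt ((m : ℝ) + 1) : ℂ) *
        inner ℂ (displacedNumber α n) (displacedNumber β (m + 1))
      = (Real.sqrt n : ℂ) * inner ℂ (displacedNumber α (n - 1)) (displacedNumber β m)
        - conj (β - α) * inner ℂ (displacedNumber α n) (displacedNumber β m) := by
  have hx := fastDecay_displacedNumberAmp α n
  have hx' := fastDecay_displacedNumberAmp α (n - 1)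
  have hy := fastDecay_displacedNumberAmp β m
  rw [inner_displacedNumber_tsum, inner_displacedNumber_tsum, inner_displacedNumber_tsum,
    ← tsum_mul_left, ← tsum_mul_left, ← tsum_mul_left]
  calc ∑' j, (Real.sqrt ((m : ℝ) + 1) : ℂ) *
        (conj (displacedNumberAmp α n j) * displacedNumberAmp β (m + 1) j)
      = ∑' j, (conj (displacedNumberAmp α n j) *
            ((Real.sqrt j : ℂ) * displacedNumberAmp β m (j - 1))
          - conj (displacedNumberAmp α n j) * (conj β * displacedNumberAmp β m j)) := by
        congr 1; funext j
        have := displacedNumberAmp_succ β m j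
        linear_combination conj (displacedNumberAmp α n j) * this
    _ = ∑' j : ℕ, (conj ((Real.sqrt ((j : ℝ) + 1) : ℂ) * displacedNumberAmp α n (j + 1)) *
            displacedNumberAmp β m j
          - conj (displacedNumberAmp α n j) * (conj β * displacedNumberAmp β m j)) := by
        rw [(hx.summable_mul hy.raise).tsum_sub (hx.summable_mul (hy.const_mul _)),
          (hx.lower.summable_mul hy).tsum_sub (hx.summable_mul (hy.const_mul _)),
          tsum_raise hx hy]
    _ = _ := by
        rw [← ((hx'.summable_mul hy).mul_left _).tsum_sub ((hx.summable_mul hy).mul_left _)]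
        congr 1; funext j
        have := congrArg conj (displacedNumberAmp_lower α n j)
        simp only [map_sub, map_mul, Complex.conj_ofReal] at this ⊢
        linear_combination displacedNumberAmp β m j * this

theorem inner_displacedNumber_succ_left (n m : ℕ) :
    (Real.sqrt ((n : ℝ) + 1) : ℂ) *
        inner ℂ (displacedNumber α (n + 1)) (displacedNumber β m)
      = (Real.sqrt m : ℂ) * inner ℂ (displacedNumber α n) (displacedNumber β (m - 1))
        + (β - α) * inner ℂ (displacedNumber α n) (displacedNumber β m) := by
  have h := congrArg conj (inner_displacedNumber_succ_right β α m n)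
  simp only [map_sub, map_mul, Complex.conj_ofReal, inner_conj_symm, Complex.conj_conj] at h
  rw [h]; ring

theorem norm_inner_displacedNumber_zero :
    ‖inner ℂ (displacedNumber α 0) (displacedNumber β 0)‖ = Real.exp (-‖α - β‖ ^ 2 / 2) := by
  have h : ∀ m : ℕ, conj (displacedNumberAmp α 0 m) * displacedNumberAmp β 0 m
      = ((Real.exp (-‖α‖ ^ 2 / 2) * Real.exp (-‖β‖ ^ 2 / 2) : ℝ) : ℂ) *
        ((conj α * β) ^ m / (Nat.factorial m : ℂ)) := by
    intro m
    have hs : (Real.sqrt (Nat.factorial m) : ℂ) ≠ 0 := by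
      rw [Complex.ofReal_ne_zero]
      exact (Real.sqrt_pos.2 (by exact_mod_cast Nat.factorial_pos m)).ne'
    rw [← sqrt_mul_self_cast (Nat.factorial m), displacedNumberAmp, displacedNumberAmp, map_div₀,
      map_mul, map_pow, Complex.conj_ofReal, Complex.conj_ofReal, mul_pow, Complex.ofReal_mul]
    field_simp
  rw [inner_displacedNumber_tsum]
  simp_rw [h]
  rw [tsum_mul_left, (NormedSpace.expSeries_div_hasSum_exp (𝔸 := ℂ) (conj α * β)).tsum_eq,
    ← Complex.exp_eq_exp_ℂ, norm_mul, Complex.norm_real, Complex.norm_exp, ← Real.exp_add,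
    Real.norm_of_nonneg (Real.exp_pos _).le, ← Real.exp_add]
  congr 1
  rw [← Complex.normSq_eq_norm_sq, ← Complex.normSq_eq_norm_sq, ← Complex.normSq_eq_norm_sq,
    Complex.normSq_sub, Complex.normSq_apply]
  simp
  ring

end DisplacementInner

/-! ### Diagonal matrix elements as Laguerre polynomials, and their thermal average. -/

section DiagonalOverlap

/-- The sum is the Laguerre polynomial `L_n(|α - β|²)`. After rescaling by `√n! √m!`, passing from
row `n` to row `n + 1` applies `S + (β - α)`, where `S` is a weighted shift, and row `0` is
geometric; the binomial theorem then gives row `n`. -/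
theorem inner_displacedNumber_self_index (α β : ℂ) (n : ℕ) :
    inner ℂ (displacedNumber α n) (displacedNumber β n)
      = inner ℂ (displacedNumber α 0) (displacedNumber β 0) *
        ((∑ j ∈ Finset.range (n + 1), (n.choose j : ℝ) * ((-‖α - β‖ ^ 2) ^ j / j.factorial) : ℝ) :
          ℂ) := by
  set I : ℕ → ℕ → ℂ := fun n m => inner ℂ (displacedNumber α n) (displacedNumber β m) with hI
  let J : ℕ → ℕ → ℂ := fun n m =>
    (Real.sqrt n.factorial : ℂ) * (Real.sqrt m.factorial : ℂ) * I n m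
  let S : Module.End ℂ (ℕ → ℂ) :=
    { toFun := fun f m => m * f (m - 1)
      map_add' := fun f g => by funext m; simp [mul_add]
      map_smul' := fun c f => by funext m; simp; ring }
  have hfac : ∀ n : ℕ, (Real.sqrt (n + 1).factorial : ℂ) =
      (Real.sqrt ((n : ℝ) + 1) : ℂ) * (Real.sqrt n.factorial : ℂ) := by
    intro n
    rw [← Complex.ofReal_mul, ← Real.sqrt_mul (by positivity), Nat.factorial_succ]
    push_cast; rfl
  have hsq : ∀ m : ℕ, (Real.sqrt ((m : ℝ) + 1) : ℂ) * (Real.sqrt ((m : ℝ) + 1) : ℂ) = m + 1 := by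
    intro m
    have := sqrt_mul_self_cast (m + 1); push_cast at this ⊢; exact this
  have hS : ∀ (j : ℕ) (f : ℕ → ℂ) (m : ℕ), (S ^ j) f m = m.descFactorial j * f (m - j) := by
    intro j
    induction j with
    | zero => intro f m; simp
    | succ j ih =>
      intro f m
      rw [pow_succ, Module.End.mul_apply, ih]
      change _ * (((m - j : ℕ) : ℂ) * f (m - j - 1)) = _
      rw [Nat.descFactorial_succ, Nat.sub_sub]
      push_cast; ring
  have hJ : ∀ n, J (n + 1) = (S + (β - α) • (1 : Module.End ℂ (ℕ → ℂ))) (J n) := by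
    intro n
    funext m
    change (Real.sqrt (n + 1).factorial : ℂ) * (Real.sqrt m.factorial : ℂ) * I (n + 1) m =
      m * J n (m - 1) + (β - α) * J n m
    have h : (Real.sqrt ((n : ℝ) + 1) : ℂ) * I (n + 1) m =
      (Real.sqrt m : ℂ) * I n (m - 1) + (β - α) * I n m := inner_displacedNumber_succ_left α β n m
    have key : (Real.sqrt m.factorial : ℂ) * (Real.sqrt m : ℂ) * I n (m - 1) =
        m * ((Real.sqrt (m - 1).factorial : ℂ) * I n (m - 1)) := by
      rcases m with _ | m
      · simp
      · rw [hfac, Nat.add_sub_cancel]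
        push_cast
        linear_combination (Real.sqrt m.factorial : ℂ) * I n m * hsq m
    rw [hfac]
    simp only [J]
    linear_combination (Real.sqrt n.factorial : ℂ) * (Real.sqrt m.factorial : ℂ) * h
      + (Real.sqrt n.factorial : ℂ) * key
  have hJ0 : ∀ m, J 0 m = I 0 0 * (-conj (β - α)) ^ m := by
    intro m
    induction m with
    | zero => simp [J]
    | succ m ih =>
      have h : (Real.sqrt ((m : ℝ) + 1) : ℂ) * I 0 (m + 1) =
        (Real.sqrt (0 : ℕ) : ℂ) * I (0 - 1) m - conj (β - α) * I 0 m :=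
        inner_displacedNumber_succ_right α β 0 m
      simp only [Nat.cast_zero, Real.sqrt_zero, Complex.ofReal_zero, zero_mul, zero_sub] at h
      simp only [J] at ih ⊢
      rw [hfac, pow_succ]
      linear_combination (Real.sqrt (Nat.factorial 0) : ℂ) * (Real.sqrt m.factorial : ℂ) * h
        - conj (β - α) * ih
  have hJn : J n = ((S + (β - α) • (1 : Module.End ℂ (ℕ → ℂ))) ^ n) (J 0) := by
    clear_value J
    induction n with
    | zero => simp
    | succ n ih => rw [hJ, ih, pow_succ', Module.End.mul_apply]
  have hcomm : Commute S ((β - α) • (1 : Module.End ℂ (ℕ → ℂ))) :=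
    (Commute.one_right S).smul_right _
  have hc : (β - α) * (-conj (β - α)) = ((-‖α - β‖ ^ 2 : ℝ) : ℂ) := by
    rw [mul_neg, Complex.mul_conj, Complex.normSq_eq_norm_sq, norm_sub_rev]; simp
  have hnn : J n n = ∑ j ∈ Finset.range (n + 1),
      I 0 0 * ((n.descFactorial j : ℂ) * ((-‖α - β‖ ^ 2 : ℝ) : ℂ) ^ (n - j) * n.choose j) := by
    rw [hJn, hcomm.add_pow, LinearMap.sum_apply, Finset.sum_apply]
    refine Finset.sum_congr rfl fun j _ => ?_
    have hnat : ((n.choose j : ℕ) : Module.End ℂ (ℕ → ℂ)) (J 0) = (n.choose j : ℂ) • J 0 := by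
      rw [Module.End.natCast_apply, Nat.cast_smul_eq_nsmul]
    rw [← hc, mul_pow, Module.End.mul_apply, Module.End.mul_apply, hS, smul_pow, one_pow,
      LinearMap.smul_apply, Module.End.one_apply, hnat, Pi.smul_apply, Pi.smul_apply, smul_eq_mul,
      smul_eq_mul, hJ0]
    ring
  have hn0 : (n.factorial : ℂ) ≠ 0 := by exact_mod_cast n.factorial_ne_zero
  have hJI : J n n = n.factorial * I n n := by
    simp only [J]
    rw [sqrt_mul_self_cast]
  apply mul_left_cancel₀ hn0
  change n.factorial * I n n = _
  rw [← hJI, hnn, ← Finset.mul_sum, ← Finset.sum_range_reflect, Complex.ofReal_sum, mul_left_comm,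
    Finset.mul_sum (a := (n.factorial : ℂ))]
  change I 0 0 * _ = I 0 0 * _
  congr 1
  refine Finset.sum_congr rfl fun j hj => ?_
  have hj' : j ≤ n := Nat.lt_succ_iff.1 (Finset.mem_range.1 hj)
  have e1 : n + 1 - 1 - j = n - j := by omega
  have e2 : n - (n - j) = j := by omega
  have h3 := Nat.factorial_mul_descFactorial (Nat.sub_le n j)
  rw [e2] at h3
  rw [e1, e2, Nat.choose_symm hj', ← h3]
  have : (j.factorial : ℂ) ≠ 0 := by exact_mod_cast j.factorial_ne_zero
  push_cast
  field_simp

/-- These binomial moments of the geometric distribution turn the thermal average of the Laguerre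
sums into the exponential series of `N t`. -/
theorem hasSum_thermalWeight_mul_choose {N : ℝ} (hN : 0 ≤ N) (j : ℕ) :
    HasSum (fun n => thermalWeight N n * (n.choose j : ℝ)) (N ^ j) := by
  have hq : ‖N / (N + 1)‖ < 1 := by
    rw [Real.norm_of_nonneg (by positivity)]; exact div_add_one_lt_one hN
  have h := (hasSum_choose_mul_geometric_of_norm_lt_one j hq).mul_left
    ((N / (N + 1)) ^ j * (N + 1)⁻¹)
  have hN1 : N + 1 ≠ 0 := by positivity
  have e : (N / (N + 1)) ^ j * (N + 1)⁻¹ * (1 / (1 - N / (N + 1)) ^ (j + 1)) = N ^ j := by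
    have : 1 - N / (N + 1) = (N + 1)⁻¹ := by field_simp; ring
    rw [this, div_pow, inv_pow, pow_succ]
    field_simp
  rw [e] at h
  -- The terms with `n < j` vanish, so the sum may be reindexed by `n + j`.
  rw [← (add_left_injective j).hasSum_iff]
  · refine h.congr_of_eq fun n => ?_
    rw [Function.comp_apply, thermalWeight_eq hN, pow_add]
    ring
  · intro n hn
    have : n < j := by
      by_contra hlt
      exact hn ⟨n - j, by simp only; omega⟩
    rw [Nat.choose_eq_zero_of_lt this]; simp

/-- The generating function of the Laguerre polynomials. -/
theorem hasSum_thermalWeight_mul_laguerre {N : ℝ} (hN : 0 ≤ N) (t : ℝ) :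
    HasSum (fun n => thermalWeight N n *
      ∑ j ∈ Finset.range (n + 1), (n.choose j : ℝ) * (t ^ j / j.factorial)) (Real.exp (N * t)) := by
  let f : ℕ × ℕ → ℝ := fun p => thermalWeight N p.2 * (p.2.choose p.1 : ℝ) *
    (t ^ p.1 / p.1.factorial)
  -- With absolute values the double series is the exponential series of `N|t|`, which licenses
  -- exchanging the sums over `j` and `n`.
  have hf : Summable f := by
    rw [← summable_norm_iff, summable_prod_of_nonneg fun p => norm_nonneg _]
    have hr : ∀ j, HasSum (fun n => ‖f (j, n)‖) (N ^ j * (|t| ^ j / j.factorial)) := by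
      intro j
      refine ((hasSum_thermalWeight_mul_choose hN j).mul_right
        (|t| ^ j / j.factorial)).congr_of_eq fun n => ?_
      simp only [f, norm_mul, norm_div, norm_pow, Real.norm_eq_abs, Nat.abs_cast,
        abs_of_nonneg (thermalWeight_nonneg hN n)]
    refine ⟨fun j => (hr j).summable, ?_⟩
    simp only [(hr _).tsum_eq]
    refine (Real.summable_pow_div_factorial (N * |t|)).congr fun j => ?_
    rw [mul_pow]; ring
  have h1 := hf.hasSum.prod_fiberwise fun j =>
    (hasSum_thermalWeight_mul_choose hN j).mul_right (t ^ j / j.factorial)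
  have h2 := ((Equiv.prodComm ℕ ℕ).hasSum_iff.2 hf.hasSum).prod_fiberwise (g := fun n =>
    thermalWeight N n * ∑ j ∈ Finset.range (n + 1), (n.choose j : ℝ) * (t ^ j / j.factorial)) ?_
  · have h3 := NormedSpace.expSeries_div_hasSum_exp (𝔸 := ℝ) (N * t)
    rw [← Real.exp_eq_exp_ℝ] at h3
    have h4 : ∑' p, f p = Real.exp (N * t) := by
      refine h1.unique ?_
      refine h3.congr_of_eq fun j => ?_
      rw [mul_pow]; ring
    rwa [h4] at h2
  · intro n
    rw [Finset.mul_sum]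
    have h5 : ∀ j ∉ Finset.range (n + 1), f (j, n) = 0 := by
      intro j hj
      have : n < j := by
        rw [Finset.mem_range] at hj; omega
      simp [f, Nat.choose_eq_zero_of_lt this]
    have h6 : HasSum (fun j => f (j, n)) _ := hasSum_sum_of_ne_finset_zero h5
    have h7 : ∑ j ∈ Finset.range (n + 1), f (j, n) = ∑ j ∈ Finset.range (n + 1),
        thermalWeight N n * ((n.choose j : ℝ) * (t ^ j / j.factorial)) :=
      Finset.sum_congr rfl fun j _ => by simp only [f]; ring
    rwa [h7] at h6

end DiagonalOverlap

/-! ### First choice of factors: `D(α)√τ`. -/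

section Factor

variable {N : ℝ}

theorem comp_adjoint_displaced_thermalRoot (hN : 0 ≤ N) (α : ℂ) :
    (displacementL α ∘L thermalRoot N) ∘L
      ContinuousLinearMap.adjoint (displacementL α ∘L thermalRoot N) = displacedThermal N α := by
  rw [ContinuousLinearMap.adjoint_comp, adjoint_thermalRoot hN, displacedThermal,
    ← thermalRoot_comp_self hN]
  rfl

theorem displaced_thermalRoot_single (hN : 0 ≤ N) (α : ℂ) (n : ℕ) :
    (displacementL α ∘L thermalRoot N) (lp.single 2 n 1)
      = (Real.sqrt (thermalWeight N n) : ℂ) • displacedNumber α n := by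
  rw [ContinuousLinearMap.comp_apply, thermalRoot_single hN, map_smul, displacementL_single]

theorem hasSum_norm_sq_displaced_thermalRoot (hN : 0 ≤ N) (α : ℂ) :
    HasSum (fun n => ‖(displacementL α ∘L thermalRoot N) (lp.single 2 n 1)‖ ^ 2) 1 := by
  convert hasSum_thermalWeight hN using 2 with n
  rw [displaced_thermalRoot_single hN, norm_smul, (orthonormal_displacedNumber α).1 n,
    Complex.norm_real, Real.norm_of_nonneg (Real.sqrt_nonneg _), mul_one,
    Real.sq_sqrt (thermalWeight_nonneg hN n)]

/-- The vacuum overlap contributes `exp(-|α - β|²/2)` and the thermal average of the Laguerre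
polynomials contributes `exp(-N|α - β|²)`. -/
theorem norm_tsum_inner_displaced_thermalRoot (hN : 0 ≤ N) (α β : ℂ) :
    ‖∑' n, inner ℂ ((displacementL α ∘L thermalRoot N) (lp.single 2 n 1))
        ((displacementL β ∘L thermalRoot N) (lp.single 2 n 1))‖
      = Real.exp (-(N + 1 / 2) * ‖α - β‖ ^ 2) := by
  have h := ((hasSum_thermalWeight_mul_laguerre hN (-‖α - β‖ ^ 2)).mapL
    Complex.ofRealCLM).mul_left (inner ℂ (displacedNumber α 0) (displacedNumber β 0))
  have h2 := h.congr_of_eq (g := fun n =>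
    inner ℂ ((displacementL α ∘L thermalRoot N) (lp.single 2 n 1))
        ((displacementL β ∘L thermalRoot N) (lp.single 2 n 1))) fun n => ?_
  · rw [h2.tsum_eq, norm_mul, norm_inner_displacedNumber_zero, Complex.ofRealCLM_apply,
      Complex.norm_real, Real.norm_of_nonneg (Real.exp_pos _).le, ← Real.exp_add]
    congr 1; ring
  · rw [displaced_thermalRoot_single hN, displaced_thermalRoot_single hN, inner_smul_left,
      inner_smul_right, Complex.conj_ofReal, ← mul_assoc, ← Complex.ofReal_mul,
      Real.mul_self_sqrt (thermalWeight_nonneg hN n), inner_displacedNumber_self_index,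
      Complex.ofRealCLM_apply, Complex.ofReal_mul]
    ring

end Factor

/-! ### Second choice of factors, with overlap `tr √S_N(α)√S_N(β)`. -/

section SymmetricOverlap

variable {N : ℝ} (α β : ℂ)

/-- The displaced number state `D(α)|n⟩` in the displaced number basis of `D(β)`. -/
noncomputable def relativeNumber (n : ℕ) : Fock :=
  ContinuousLinearMap.adjoint (displacementL β) (displacedNumber α n)

theorem relativeNumber_apply (n m : ℕ) :
    relativeNumber α β n m = inner ℂ (displacedNumber β m) (displacedNumber α n) := by
  rw [← inner_single_one m, relativeNumber, ContinuousLinearMap.adjoint_inner_right,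
    displacementL_single]

theorem inner_relativeNumber (n n' : ℕ) :
    inner ℂ (relativeNumber α β n) (relativeNumber α β n') = if n = n' then (1 : ℂ) else 0 := by
  rw [relativeNumber, relativeNumber, ContinuousLinearMap.adjoint_inner_left,
    ← ContinuousLinearMap.comp_apply, displacementL_comp_adjoint, one_apply_eq_self,
    inner_displacedNumber_eq]

theorem norm_relativeNumber (n : ℕ) : ‖relativeNumber α β n‖ = 1 := by
  have h := inner_relativeNumber α β n n
  rw [if_pos rfl] at h
  rw [@norm_eq_sqrt_re_inner ℂ, h]
  simp

theorem hasSum_norm_sq_relativeNumber_row (n : ℕ) :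
    HasSum (fun m => ‖relativeNumber α β n m‖ ^ 2) 1 := by
  have h := hasSum_norm_sq (relativeNumber α β n)
  rwa [norm_relativeNumber, one_pow] at h

theorem hasSum_norm_sq_relativeNumber_col (m : ℕ) :
    HasSum (fun n => ‖relativeNumber α β n m‖ ^ 2) 1 := by
  refine (hasSum_norm_sq_relativeNumber_row β α m).congr_of_eq fun n => ?_
  rw [relativeNumber_apply, relativeNumber_apply, ← inner_conj_symm, RCLike.norm_conj]

/-- The mean photon number of `D(α - β)|n⟩` is `n + |α - β|²`. -/
theorem hasSum_mul_norm_sq_relativeNumber (n : ℕ) :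
    HasSum (fun m : ℕ => (m : ℝ) * ‖relativeNumber α β n m‖ ^ 2) (n + ‖α - β‖ ^ 2) := by
  -- `z` is the annihilation operator applied to `relativeNumber α β n`. Its squared norm is the
  -- mean photon number, and orthonormality evaluates it.
  set z : Fock := (Real.sqrt n : ℂ) • relativeNumber α β (n - 1) - (β - α) • relativeNumber α β n
    with hz
  have hzm : ∀ m : ℕ, ‖z m‖ ^ 2 = ((m + 1 : ℕ) : ℝ) * ‖relativeNumber α β n (m + 1)‖ ^ 2 := by
    intro m
    have h := congrArg conj (inner_displacedNumber_succ_right α β n m)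
    simp only [map_sub, map_mul, Complex.conj_ofReal, inner_conj_symm, Complex.conj_conj] at h
    have e : z m = (Real.sqrt n : ℂ) * relativeNumber α β (n - 1) m
      - (β - α) * relativeNumber α β n m := rfl
    rw [e, relativeNumber_apply, relativeNumber_apply, ← h, relativeNumber_apply,
      norm_mul, mul_pow, Complex.norm_real, Real.norm_of_nonneg (Real.sqrt_nonneg _),
      Real.sq_sqrt (by positivity)]
    push_cast; rfl
  have hzn : ‖z‖ ^ 2 = n + ‖α - β‖ ^ 2 := by
    have h0 : (Real.sqrt n : ℂ) * inner ℂ (relativeNumber α β (n - 1)) (relativeNumber α β n)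
        = 0 := by
      rcases n with _ | n
      · simp
      · rw [inner_relativeNumber, if_neg (by omega), mul_zero]
    rw [hz, @norm_sub_sq ℂ, inner_smul_left, inner_smul_right, Complex.conj_ofReal, mul_left_comm,
      h0, norm_smul, norm_smul, norm_relativeNumber, norm_relativeNumber, Complex.norm_real,
      Real.norm_of_nonneg (Real.sqrt_nonneg _), mul_one, mul_one, Real.sq_sqrt (by positivity),
      norm_sub_rev]
    simp
  have h := hasSum_norm_sq z
  rw [hzn] at h
  have h2 := (hasSum_nat_add_iff (f := fun m : ℕ => (m : ℝ) * ‖relativeNumber α β n m‖ ^ 2) 1).1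
    (h.congr_of_eq fun m => (hzm m).symm)
  simpa using h2

/-- Jensen's inequality: `√(thermalWeight N m)` is a convex exponential in `m`, averaged over the
photon number distribution of `relativeNumber α β n`, whose mean is `n + |α - β|²`. -/
theorem le_tsum_sqrt_thermalWeight_mul (hN : 0 < N) (n : ℕ) :
    Summable (fun m => Real.sqrt (thermalWeight N m) * ‖relativeNumber α β n m‖ ^ 2) ∧
    Real.sqrt (thermalWeight N n) * Real.exp (-(‖α - β‖ ^ 2 / (2 * N))) ≤
      ∑' m, Real.sqrt (thermalWeight N m) * ‖relativeNumber α β n m‖ ^ 2 := by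
  set t := ‖α - β‖ ^ 2 with ht
  set w : ℕ → ℝ := fun m => ‖relativeNumber α β n m‖ ^ 2 with hw
  have hq : 0 < N / (N + 1) := by positivity
  set s := -Real.log (Real.sqrt (N / (N + 1))) with hs
  have hx : Real.sqrt (N / (N + 1)) = Real.exp (-s) := by
    rw [hs, neg_neg, Real.exp_log (Real.sqrt_pos.2 hq)]
  -- Here `s = log(1 + 1/N)/2`, and `log(1 + x) ≤ x`.
  have hs1 : s ≤ 1 / (2 * N) := by
    have h := Real.log_le_sub_one_of_pos (x := (N + 1) / N) (by positivity)
    have e : s = Real.log ((N + 1) / N) / 2 := by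
      rw [hs, Real.log_sqrt hq.le, ← inv_div N, Real.log_inv]
      ring
    have e2 : (N + 1) / N - 1 = 1 / N := by field_simp; ring
    rw [e2] at h
    rw [e, show 1 / (2 * N) = 1 / N / 2 by field_simp]
    linarith
  -- The tangent line at the mean `n + t` lies below the exponential.
  have hp : ∀ m, Real.sqrt (thermalWeight N n) * Real.exp (-s * t) *
      (1 - s * (m - n - t)) ≤ Real.sqrt (thermalWeight N m) := by
    intro m
    have e : Real.sqrt (thermalWeight N m) = Real.sqrt (thermalWeight N n) * Real.exp (-s * t) *
        Real.exp (-s * (m - n - t)) := by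
      rw [sqrt_thermalWeight_eq hN.le, sqrt_thermalWeight_eq hN.le, hx, ← Real.exp_nat_mul,
        ← Real.exp_nat_mul]
      have e2 : Real.exp (m * -s) =
          Real.exp (n * -s) * Real.exp (-s * t) * Real.exp (-s * (m - n - t)) := by
        rw [← Real.exp_add, ← Real.exp_add]
        congr 1; ring
      rw [e2]; ring
    rw [e]
    refine mul_le_mul_of_nonneg_left ?_ (by positivity)
    have := Real.add_one_le_exp (-s * (m - n - t))
    linarith
  have hsum : Summable fun m => Real.sqrt (thermalWeight N m) * w m := by
    refine Summable.of_nonneg_of_le (fun m => by positivity) (fun m => ?_)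
      (hasSum_norm_sq_relativeNumber_row α β n).summable
    have : Real.sqrt (thermalWeight N m) ≤ 1 := by
      rw [Real.sqrt_le_one]
      exact le_hasSum (hasSum_thermalWeight hN.le) m fun j _ => thermalWeight_nonneg hN.le j
    exact mul_le_of_le_one_left (by positivity) this
  refine ⟨hsum, ?_⟩
  -- Averaging the tangent line needs only total mass `1` and mean `n + t`; the linear term cancels.
  have h1 := ((hasSum_norm_sq_relativeNumber_row α β n).mul_left (1 + s * (n + t))).sub
    ((hasSum_mul_norm_sq_relativeNumber α β n).mul_left s)
  have h2 := h1.mul_left (Real.sqrt (thermalWeight N n) * Real.exp (-s * t))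
  have h3 := hasSum_le (fun m => ?_) h2 hsum.hasSum
  · refine le_trans (le_of_le_of_eq (b := Real.sqrt (thermalWeight N n) * Real.exp (-s * t))
      ?_ ?_) h3
    · refine mul_le_mul_of_nonneg_left (Real.exp_le_exp.2 ?_) (Real.sqrt_nonneg _)
      have : s * t ≤ 1 / (2 * N) * t := mul_le_mul_of_nonneg_right hs1 (by positivity)
      have e : t / (2 * N) = 1 / (2 * N) * t := by ring
      rw [e]; linarith
    · ring
  · have := mul_le_mul_of_nonneg_right (hp m) (by positivity : 0 ≤ w m)
    refine le_trans (le_of_eq ?_) this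
    simp only [hw]; ring

/-- `√S_N(β) D(α)`. -/
noncomputable def rotatedRoot (N : ℝ) (α β : ℂ) : Fock →L[ℂ] Fock :=
  (displacementL β ∘L thermalRoot N) ∘L
    (ContinuousLinearMap.adjoint (displacementL β) ∘L displacementL α)

theorem rotatedRoot_comp_adjoint (hN : 0 ≤ N) :
    rotatedRoot N α β ∘L ContinuousLinearMap.adjoint (rotatedRoot N α β)
      = displacedThermal N β := by
  rw [← comp_adjoint_displaced_thermalRoot hN, rotatedRoot, ContinuousLinearMap.adjoint_comp,
    ContinuousLinearMap.adjoint_comp (ContinuousLinearMap.adjoint (displacementL β)),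
    ContinuousLinearMap.adjoint_adjoint]
  refine ContinuousLinearMap.ext fun x => ?_
  have h1 := fun y => DFunLike.congr_fun (displacementL_comp_adjoint α) y
  have h2 := fun y => DFunLike.congr_fun (adjoint_comp_displacementL β) y
  simp only [ContinuousLinearMap.comp_apply, one_apply_eq_self] at h1 h2 ⊢
  rw [h1, h2]

theorem rotatedRoot_single (n : ℕ) :
    rotatedRoot N α β (lp.single 2 n 1) = displacementL β (thermalRoot N (relativeNumber α β n)) := by
  simp only [rotatedRoot, ContinuousLinearMap.comp_apply, displacementL_single]
  rfl

/-- The nonnegative double sum is evaluated in the other order: by unitarity each column of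
`relativeNumber` has unit norm, leaving the sum of the thermal weights. -/
theorem hasSum_norm_sq_rotatedRoot (hN : 0 ≤ N) :
    HasSum (fun n => ‖rotatedRoot N α β (lp.single 2 n 1)‖ ^ 2) 1 := by
  let f : ℕ × ℕ → ℝ := fun p => thermalWeight N p.1 * ‖relativeNumber α β p.2 p.1‖ ^ 2
  have hcol : ∀ m, HasSum (fun n => f (m, n)) (thermalWeight N m) := fun m => by
    simpa using (hasSum_norm_sq_relativeNumber_col α β m).mul_left (thermalWeight N m)
  have hf : Summable f := by
    rw [summable_prod_of_nonneg fun p => mul_nonneg (thermalWeight_nonneg hN _) (sq_nonneg _)]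
    refine ⟨fun m => (hcol m).summable, ?_⟩
    exact (hasSum_thermalWeight hN).summable.congr fun m => ((hcol m).tsum_eq).symm
  have h0 : HasSum f 1 := by
    have := hf.hasSum
    rwa [(hf.hasSum.prod_fiberwise hcol).unique (hasSum_thermalWeight hN)] at this
  refine ((Equiv.prodComm ℕ ℕ).hasSum_iff.2 h0).prod_fiberwise fun n => ?_
  rw [rotatedRoot_single]
  have e : ‖displacementL β (thermalRoot N (relativeNumber α β n))‖ =
    ‖thermalRoot N (relativeNumber α β n)‖ := (displacement β).norm_map _
  rw [e]
  refine (hasSum_norm_sq _).congr_of_eq fun m => ?_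
  rw [thermalRoot_apply hN, norm_mul, mul_pow, Complex.norm_real,
    Real.norm_of_nonneg (Real.sqrt_nonneg _), Real.sq_sqrt (thermalWeight_nonneg hN m)]
  rfl

/-- Each summand is `√(thermalWeight N n)` times the Jensen average, hence at least `thermalWeight N
n` times the exponential, and the weights sum to `1`. -/
theorem norm_tsum_inner_rotatedRoot_ge (hN : 0 < N) :
    Real.exp (-(‖α - β‖ ^ 2 / (2 * N))) ≤
      ‖∑' n, inner ℂ ((displacementL α ∘L thermalRoot N) (lp.single 2 n 1))
        (rotatedRoot N α β (lp.single 2 n 1))‖ := by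
  set a : ℕ → ℝ := fun n => Real.sqrt (thermalWeight N n) *
    ∑' m, Real.sqrt (thermalWeight N m) * ‖relativeNumber α β n m‖ ^ 2 with ha
  have hin : ∀ n, inner ℂ ((displacementL α ∘L thermalRoot N) (lp.single 2 n 1))
        (rotatedRoot N α β (lp.single 2 n 1)) = (a n : ℂ) := by
    intro n
    rw [displaced_thermalRoot_single hN.le, rotatedRoot_single, inner_smul_left,
      Complex.conj_ofReal, ← ContinuousLinearMap.adjoint_inner_left]
    change _ * inner ℂ (relativeNumber α β n) _ = _
    rw [ha, Complex.ofReal_mul]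
    congr 1
    have h1 := hasSum_conj_mul (relativeNumber α β n) (thermalRoot N (relativeNumber α β n))
    have h2 := (le_tsum_sqrt_thermalWeight_mul α β hN n).1.hasSum.mapL Complex.ofRealCLM
    refine h1.unique (h2.congr_of_eq fun m => ?_)
    rw [thermalRoot_apply hN.le, mul_left_comm, Complex.conj_mul', Complex.ofRealCLM_apply]
    push_cast; rfl
  have hsum : Summable a := by
    rw [← Complex.summable_ofReal]
    have hF := (hasSum_norm_sq_displaced_thermalRoot hN.le α).summable
    have hG := (hasSum_norm_sq_rotatedRoot α β hN.le).summable
    refine Summable.of_norm_bounded (hF.add hG) fun n => ?_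
    rw [← hin n]
    refine (norm_inner_le_norm _ _).trans ?_
    nlinarith [sq_nonneg (‖(displacementL α ∘L thermalRoot N) (lp.single 2 n 1)‖ -
      ‖rotatedRoot N α β (lp.single 2 n 1)‖), sq_nonneg
      (‖(displacementL α ∘L thermalRoot N) (lp.single 2 n 1)‖ +
      ‖rotatedRoot N α β (lp.single 2 n 1)‖)]
  simp_rw [hin]
  rw [← Complex.ofReal_tsum, Complex.norm_real]
  refine le_trans ?_ (le_abs_self _)
  have h := (hasSum_thermalWeight hN.le).mul_right (Real.exp (-(‖α - β‖ ^ 2 / (2 * N))))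
  rw [one_mul] at h
  refine hasSum_le (fun n => ?_) h hsum.hasSum
  have := mul_le_mul_of_nonneg_left (le_tsum_sqrt_thermalWeight_mul α β hN n).2
    (Real.sqrt_nonneg (thermalWeight N n))
  rwa [← mul_assoc, Real.mul_self_sqrt (thermalWeight_nonneg hN.le n)] at this

/-- Factorisations of two displaced thermal states with a large Hilbert–Schmidt overlap. -/
theorem exists_factor (hN : 0 ≤ N) : ∃ F G : Fock →L[ℂ] Fock,
    F ∘L ContinuousLinearMap.adjoint F = displacedThermal N α ∧
    G ∘L ContinuousLinearMap.adjoint G = displacedThermal N β ∧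
    HasSum (fun n => ‖F (lp.single 2 n 1)‖ ^ 2) 1 ∧
    HasSum (fun n => ‖G (lp.single 2 n 1)‖ ^ 2) 1 ∧
    Real.exp (-(2 * ‖α - β‖ ^ 2 / (2 * N + 1))) ≤
      ‖∑' n, inner ℂ (F (lp.single 2 n 1)) (G (lp.single 2 n 1))‖ := by
  have ht : 0 ≤ ‖α - β‖ ^ 2 := by positivity
  -- Both thresholds meet at `1/2`: `N + 1/2 ≤ 2/(2N+1)` holds exactly for `N ≤ 1/2`, and `1/(2N) ≤
  -- 2/(2N+1)` exactly for `N ≥ 1/2`.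
  rcases le_total N (1 / 2) with h | h
  · refine ⟨_, _, comp_adjoint_displaced_thermalRoot hN α, comp_adjoint_displaced_thermalRoot hN β,
      hasSum_norm_sq_displaced_thermalRoot hN α, hasSum_norm_sq_displaced_thermalRoot hN β, ?_⟩
    rw [norm_tsum_inner_displaced_thermalRoot hN, Real.exp_le_exp, neg_mul, neg_le_neg_iff,
      le_div_iff₀ (by positivity)]
    have : (N + 1 / 2) * (2 * N + 1) ≤ 2 := by nlinarith
    nlinarith
  · have hN' : 0 < N := by linarith
    refine ⟨_, _, comp_adjoint_displaced_thermalRoot hN α, rotatedRoot_comp_adjoint α β hN,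
      hasSum_norm_sq_displaced_thermalRoot hN α, hasSum_norm_sq_rotatedRoot α β hN,
      le_trans ?_ (norm_tsum_inner_rotatedRoot_ge α β hN')⟩
    rw [Real.exp_le_exp, neg_le_neg_iff, div_le_div_iff₀ (by positivity) (by positivity)]
    nlinarith

end SymmetricOverlap

/-! ### Factors and overlaps for `k` modes. -/

section TensorFactor

variable {k : ℕ}

theorem tensorOp_single_apply (A : Fin k → (Fock →L[ℂ] Fock)) (n m : Fin k → ℕ) :
    tensorOp A (lp.single 2 n 1) m = ∏ i, A i (lp.single 2 (n i) 1) (m i) := by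
  refine tensorOp_product A (fun i => lp.single 2 (n i) 1) _ (fun m => ?_) m
  rw [lp.coeFn_single]
  by_cases h : m = n
  · subst h; simp
  · obtain ⟨i, hi⟩ := Function.ne_iff.1 h
    rw [Pi.single_eq_of_ne h, eq_comm]
    refine Finset.prod_eq_zero (Finset.mem_univ i) ?_
    rw [lp.coeFn_single, Pi.single_eq_of_ne hi]

/-- Bounded operators are determined by the number states, and these are product vectors, on which
`tensorOp` acts factor by factor. -/
theorem tensorOp_comp (A B : Fin k → (Fock →L[ℂ] Fock)) :
    tensorOp A ∘L tensorOp B = tensorOp fun i => A i ∘L B i := by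
  refine clm_ext_single fun n => lp.ext (funext fun m => ?_)
  rw [tensorOp_single_apply, ContinuousLinearMap.comp_apply]
  exact tensorOp_product A (fun i => B i (lp.single 2 (n i) 1)) _
    (fun m => tensorOp_single_apply B n m) m

theorem adjoint_tensorOp (A : Fin k → (Fock →L[ℂ] Fock)) :
    ContinuousLinearMap.adjoint (tensorOp A) =
      tensorOp fun i => ContinuousLinearMap.adjoint (A i) := by
  refine clm_ext_single fun n => lp.ext (funext fun m => ?_)
  rw [← inner_single_one m, ContinuousLinearMap.adjoint_inner_right, ← inner_conj_symm,
    inner_single_one, tensorOp_single_apply, tensorOp_single_apply, map_prod]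
  refine Finset.prod_congr rfl fun i _ => ?_
  rw [← inner_single_one (m i), ContinuousLinearMap.adjoint_inner_right, ← inner_conj_symm,
    inner_single_one]

theorem inner_tensorOp_single (A B : Fin k → (Fock →L[ℂ] Fock)) (n : Fin k → ℕ) :
    inner ℂ (tensorOp A (lp.single 2 n 1)) (tensorOp B (lp.single 2 n 1))
      = ∏ i, inner ℂ (A i (lp.single 2 (n i) 1)) (B i (lp.single 2 (n i) 1)) := by
  have h := fun i => hasSum_conj_mul (A i (lp.single 2 (n i) 1)) (B i (lp.single 2 (n i) 1))
  have h2 := (hasSum_pi_prod _ fun i => (h i).summable.norm).2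
  simp only [(h _).tsum_eq] at h2
  refine (hasSum_conj_mul _ _).unique (h2.congr_of_eq fun m => ?_)
  rw [tensorOp_single_apply, tensorOp_single_apply, map_prod, ← Finset.prod_mul_distrib]

theorem summable_norm_inner_of_hasSum {ι H : Type*} [NormedAddCommGroup H] [InnerProductSpace ℂ H]
    {x y : ι → H} {a b : ℝ} (hx : HasSum (fun i => ‖x i‖ ^ 2) a)
    (hy : HasSum (fun i => ‖y i‖ ^ 2) b) : Summable fun i => ‖(inner ℂ (x i) (y i) : ℂ)‖ := by
  refine Summable.of_nonneg_of_le (fun _ => norm_nonneg _) (fun i => ?_)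
    (hx.add hy).summable
  refine (norm_inner_le_norm _ _).trans ?_
  nlinarith [sq_nonneg (‖x i‖ - ‖y i‖), sq_nonneg (‖x i‖ + ‖y i‖)]

theorem hasSum_inner_tensorOp_single {A B : Fin k → (Fock →L[ℂ] Fock)}
    (hA : ∀ i, HasSum (fun n => ‖A i (lp.single 2 n 1)‖ ^ 2) 1)
    (hB : ∀ i, HasSum (fun n => ‖B i (lp.single 2 n 1)‖ ^ 2) 1) :
    HasSum (fun n => inner ℂ (tensorOp A (lp.single 2 n 1)) (tensorOp B (lp.single 2 n 1)))
      (∏ i, ∑' n, inner ℂ (A i (lp.single 2 n 1)) (B i (lp.single 2 n 1))) :=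
  (hasSum_pi_prod (fun i n => inner ℂ (A i (lp.single 2 n 1)) (B i (lp.single 2 n 1)))
    fun i => summable_norm_inner_of_hasSum (hA i) (hB i)).2.congr_of_eq
      fun n => inner_tensorOp_single A B n

theorem hasSum_norm_sq_tensorOp_single {A : Fin k → (Fock →L[ℂ] Fock)}
    (hA : ∀ i, HasSum (fun n => ‖A i (lp.single 2 n 1)‖ ^ 2) 1) :
    HasSum (fun n => ‖tensorOp A (lp.single 2 n 1)‖ ^ 2) 1 := by
  have h := hasSum_inner_tensorOp_single hA hA
  have h1 : ∀ i, ∑' n, inner ℂ (A i (lp.single 2 n 1)) (A i (lp.single 2 n 1)) = (1 : ℂ) := by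
    intro i
    have h2 := (hA i).mapL Complex.ofRealCLM
    refine HasSum.tsum_eq (h2.congr_of_eq fun n => ?_) |>.trans (by simp)
    rw [inner_self_eq_norm_sq_to_K]
    simp
  simp only [h1, Finset.prod_const_one] at h
  have h3 := h.mapL Complex.reCLM
  rw [Complex.reCLM_apply, Complex.one_re] at h3
  refine h3.congr_of_eq fun n => ?_
  rw [Complex.reCLM_apply]
  exact (inner_self_eq_norm_sq (𝕜 := ℂ) _).symm

theorem displacedThermalK_eq_comp_adjoint {N : ℝ} {α : EuclideanSpace ℂ (Fin k)}
    {F : Fin k → (Fock →L[ℂ] Fock)}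
    (hF : ∀ i, F i ∘L ContinuousLinearMap.adjoint (F i) = displacedThermal N (α i)) :
    displacedThermalK N α = tensorOp F ∘L ContinuousLinearMap.adjoint (tensorOp F) := by
  rw [adjoint_tensorOp, tensorOp_comp, displacedThermalK]
  simp only [hF]

end TensorFactor

/-! ### From tests to separation of the signatures. -/

/-- A test that separates the states `F F†` and `G G†` bounds the overlap of `F` and `G`. -/
theorem norm_tsum_inner_le_of_test {k : ℕ} {F G P : FockK k →L[ℂ] FockK k} {δ : ℝ}
    (hδ : 0 < δ) (hP0 : 0 ≤ P) (hP1 : P ≤ 1)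
    (hF : HasSum (fun n => ‖F (lp.single 2 n 1)‖ ^ 2) 1)
    (hG : HasSum (fun n => ‖G (lp.single 2 n 1)‖ ^ 2) 1)
    (h1 : 1 - (trace ((F ∘L ContinuousLinearMap.adjoint F) * P)).re ≤ δ)
    (h2 : (trace ((G ∘L ContinuousLinearMap.adjoint G) * P)).re ≤ δ) :
    ‖∑' n, inner ℂ (F (lp.single 2 n 1)) (G (lp.single 2 n 1))‖ ≤ 2 * Real.sqrt δ := by
  set r := Real.sqrt δ with hr
  have hr0 : 0 < r := Real.sqrt_pos.2 hδ
  have hrr : r * r = δ := Real.mul_self_sqrt hδ.le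
  have hQ0 : 0 ≤ 1 - P := sub_nonneg.2 hP1
  have tF := (hasSum_inner_comp_adjoint F P hF.summable).mapL Complex.reCLM
  have tG := (hasSum_inner_comp_adjoint G P hG.summable).mapL Complex.reCLM
  set a := (trace ((F ∘L ContinuousLinearMap.adjoint F) * P)).re
  set b := (trace ((G ∘L ContinuousLinearMap.adjoint G) * P)).re
  replace tF : HasSum (fun n => (inner ℂ (F (lp.single 2 n 1)) (P (F (lp.single 2 n 1)))).re) a := tF
  replace tG : HasSum (fun n => (inner ℂ (G (lp.single 2 n 1)) (P (G (lp.single 2 n 1)))).re) b := tG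
  have hcompl : ∀ x : FockK k, (inner ℂ x ((1 - P) x)).re = ‖x‖ ^ 2 - (inner ℂ x (P x)).re := by
    intro x
    rw [sub_apply, one_apply_eq_self, inner_sub_right, Complex.sub_re]
    congr 1
    exact inner_self_eq_norm_sq (𝕜 := ℂ) x
  have sF := (hF.sub tF).congr_of_eq fun n => hcompl (F (lp.single 2 n 1))
  have sG := (hG.sub tG).congr_of_eq fun n => hcompl (G (lp.single 2 n 1))
  have hb0 : 0 ≤ b := hasSum_le (fun n => re_inner_nonneg hP0 _) hasSum_zero tG
  have ha1 : 0 ≤ 1 - a := hasSum_le (fun n => re_inner_nonneg hQ0 _) hasSum_zero sF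
  -- The weight is `r = √δ` for `P` and `r⁻¹` for `1 - P`. Of the traces, `b` and `1 - a` are at
  -- most `r²` and get divided by `r`; `a` and `1 - b` are at most `1` and get multiplied by `r`.
  -- The four terms are at most `r` each, and half their sum is at most `2r`.
  have hd := (((tF.mul_left r).add (tG.div_const r)).add
    ((sF.mul_left r⁻¹).add (sG.div_const r⁻¹))).div_const 2
  have hle : ∀ n, ‖(inner ℂ (F (lp.single 2 n 1)) (G (lp.single 2 n 1)) : ℂ)‖ ≤ _ := fun n => by
    set x := F (lp.single 2 n 1)
    set y := G (lp.single 2 n 1)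
    have e : inner ℂ x y = inner ℂ x (P y) + inner ℂ x ((1 - P) y) := by
      rw [← inner_add_right, sub_apply, one_apply_eq_self, add_sub_cancel]
    have i1 := norm_inner_le_of_nonneg hP0 x y hr0
    have i2 := norm_inner_le_of_nonneg hQ0 x y (inv_pos.2 hr0)
    have i3 : ‖(inner ℂ x y : ℂ)‖ ≤ ((r * (inner ℂ x (P x)).re + (inner ℂ y (P y)).re / r) +
        (r⁻¹ * (inner ℂ x ((1 - P) x)).re + (inner ℂ y ((1 - P) y)).re / r⁻¹)) / 2 := by
      rw [e]
      refine (norm_add_le _ _).trans ?_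
      linarith
    exact i3
  have hs := summable_norm_inner_of_hasSum hF hG
  refine (norm_tsum_le_tsum_norm hs).trans ((hasSum_le hle hs.hasSum hd).trans ?_)
  have e1 : b / r ≤ r := by
    rw [div_le_iff₀ hr0, hrr]; exact h2
  have e2 : r⁻¹ * (1 - a) ≤ r := by
    rw [inv_mul_le_iff₀ hr0, hrr]; exact h1
  have e3 : (1 - b) / r⁻¹ ≤ r := by
    rw [div_inv_eq_mul]; nlinarith
  have e4 : r * a ≤ r := by nlinarith
  linarith

/-- Distinct signatures of an identification scheme are well separated. -/
theorem IDScheme.signature_separated {k M : ℕ} {N E lam1 lam2 δ : ℝ} (hN : 0 ≤ N)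
    (C : IDScheme k M N E lam1 lam2) (hlam : max lam1 lam2 ≤ δ) (hδ : 0 < δ)
    {m m' : Fin M} (hm : m ≠ m') :
    (2 * N + 1) * Real.log (1 / (4 * δ)) ≤ (2 * ‖C.signature m - C.signature m'‖) ^ 2 := by
  choose F G hF hG sF sG hFG using fun i => exists_factor (C.signature m i) (C.signature m' i) hN
  have h1 := C.first_kind m
  have h2 := C.second_kind m m' hm.symm
  rw [displacedThermalK_eq_comp_adjoint hF] at h1
  rw [displacedThermalK_eq_comp_adjoint hG] at h2
  have h := norm_tsum_inner_le_of_test hδ (C.test_nonneg m) (C.test_le_one m)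
    (hasSum_norm_sq_tensorOp_single sF) (hasSum_norm_sq_tensorOp_single sG)
    (h1.trans ((le_max_left _ _).trans hlam)) (h2.trans ((le_max_right _ _).trans hlam))
  rw [(hasSum_inner_tensorOp_single sF sG).tsum_eq, norm_prod] at h
  have h3 := (Finset.prod_le_prod (fun i _ => (Real.exp_pos _).le) fun i _ => hFG i).trans h
  have hnorm : ‖C.signature m - C.signature m'‖ ^ 2 =
      ∑ i, ‖C.signature m i - C.signature m' i‖ ^ 2 := by
    rw [EuclideanSpace.norm_sq_eq]; rfl
  rw [← Real.exp_sum, Finset.sum_neg_distrib, ← Finset.sum_div, ← Finset.mul_sum, ← hnorm] at h3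
  set t := ‖C.signature m - C.signature m'‖ ^ 2
  -- Squaring the overlap bound turns `2√δ` into `4δ` and doubles the exponent.
  have h4 : Real.exp (-(4 * t / (2 * N + 1))) ≤ 4 * δ := by
    have e : Real.exp (-(4 * t / (2 * N + 1))) = Real.exp (-(2 * t / (2 * N + 1))) ^ 2 := by
      rw [← Real.exp_nat_mul]; congr 1; push_cast; ring
    rw [e]
    refine (pow_le_pow_left₀ (Real.exp_pos _).le h3 2).trans (le_of_eq ?_)
    rw [mul_pow, Real.sq_sqrt hδ.le]; norm_num
  have h5 := (Real.le_log_iff_exp_le (by positivity)).2 h4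
  have h6 : Real.log (1 / (4 * δ)) ≤ 4 * t / (2 * N + 1) := by
    rw [one_div, Real.log_inv]; linarith
  rw [le_div_iff₀ (by positivity)] at h6
  rw [mul_pow]
  linarith


end BosonicID

/-! ### The converse bound by packing. -/

theorem theorem2 (k M : ℕ) (N E lam1 lam2 δ : ℝ) (hN : 0 ≤ N) (hE : 0 < E)
    (C : BosonicID.IDScheme k M N E lam1 lam2)
    (hlam : max lam1 lam2 ≤ δ) (hδ0 : 0 < δ) (hδ : δ < 1 / 4) :
    (M : ℝ) ≤ (1 + 4 * Real.sqrt (k * E) /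
      Real.sqrt ((2 * N + 1) * Real.log (1 / (4 * δ)))) ^ (2 * k) := by
  have hlog : 0 < Real.log (1 / (4 * δ)) := by
    apply Real.log_pos
    rw [one_lt_div (by positivity)]; linarith
  have hd : 0 < Real.sqrt ((2 * N + 1) * Real.log (1 / (4 * δ))) :=
    Real.sqrt_pos.2 (by positivity)
  -- The separation is half of the square root in the denominator, so `2R/d` produces the constant
  -- `4`; the exponent is the real dimension `2k` of `ℂ^k`.
  have h := BosonicID.card_le_of_separated_of_norm_le C.signature (Real.sqrt_nonneg (k * E))
    (half_pos hd) (fun m => Real.le_sqrt_of_sq_le (C.energy m)) fun m m' hm => by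
      have h1 := Real.sqrt_le_sqrt (C.signature_separated hN hlam hδ0 hm)
      rw [Real.sqrt_sq (by positivity)] at h1
      linarith
  rw [finrank_real_of_complex, finrank_euclideanSpace_fin] at h
  refine h.trans (le_of_eq ?_)
  congr 2
  field_simp
  ring
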